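/- All graphs are finite and simple. For a graph $G$, let $f_\infty(G)$ be the least integer $k \ge 0$ such that for all $m$ and all vectors $(r_v)_{v\in V(G)}$ in $\mathbb{R}^m$ there exist vectors $(q_v)_{v\in V(G)}$ in $\mathbb{R}^k$ with $\|r_v-r_w\|_\infty=\|q_v-q_w\|_\infty$ for all edges $vw\in E(G)$. A graph $H$ is a minor of $G$ if, up to isomorphism, $H$ is obtained from a subgraph of $G$ by contracting some edges and suppressing loops and parallel edges. A graph $G$ is an excluded minor for $f_\infty\le 2$ if $f_\infty(G)>2$ and every minor $H$ of $G$ that is not isomorphic to $G$ satisfies $f_\infty(H)\le 2$. Theorem (Main Theorem). Up to isomorphism, the excluded minors for $f_\infty\le 2$ are exactly two graphs: the wheel $W_4$ (a $4$-cycle together with one further vertex adjacent to all its vertices), and the graph $K_4+_eK_4$ obtained by gluing two copies of $K_4$ along an edge $e$ and then deleting $e$. Moreover, $f_\infty(W_4)=f_\infty(K_4+_eK_4)=3$. -/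

import Mathlib

universe u v

namespace SimpleGraph

/-- Every choice of vectors `r` in some `ℝᵐ`, indexed by the vertices of `G`, can be replaced by a
choice of vectors `q` in `ℝᵏ` with the same `ℓ_∞`-distances along all edges of `G`.
(The norm on `Fin m → ℝ` is the maximum norm.) -/
def EllInftyRealizable {V : Type u} (G : SimpleGraph V) (k : ℕ) : Prop :=
  ∀ (m : ℕ) (r : V → Fin m → ℝ), ∃ q : V → Fin k → ℝ,
    ∀ x y : V, G.Adj x y → ‖r x - r y‖ = ‖q x - q y‖

/-- The parameter `f_∞(G)`: the least `k` such that all edge distances that occur in some `ℓ_∞ᵐ`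
also occur in `ℓ_∞ᵏ`. The value is `⊤` if there is no such `k`. -/
noncomputable def fInfty {V : Type u} (G : SimpleGraph V) : ℕ∞ :=
  ⨅ (k : ℕ) (_ : G.EllInftyRealizable k), (k : ℕ∞)

/-- The graph obtained from `G` by contracting all edges of `C` (a subgraph of `G` on the same
vertex set). Its vertices are the connected components of `C`; loops and parallel edges
are suppressed. -/
def contractEdges {V : Type u} (G C : SimpleGraph V) : SimpleGraph C.ConnectedComponent where
  Adj a b := a ≠ b ∧
    ∃ x y : V, C.connectedComponentMk x = a ∧ C.connectedComponentMk y = b ∧ G.Adj x y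
  symm := ⟨fun _ _ ⟨hne, x, y, hx, hy, h⟩ => ⟨hne.symm, y, x, hy, hx, h.symm⟩⟩
  loopless := ⟨fun _ h => h.1 rfl⟩

/-- `H` is a minor of `G`: up to isomorphism, `H` is obtained from a subgraph `S` of `G` by
contracting some edges of `S`. -/
def IsMinorOf {W : Type v} {V : Type u} (H : SimpleGraph W) (G : SimpleGraph V) : Prop :=
  ∃ (S : G.Subgraph) (C : SimpleGraph S.verts),
    C ≤ S.coe ∧ Nonempty (H ≃g S.coe.contractEdges C)

/-- `G` is an excluded minor for the property `f_∞ ≤ k`: it is minor-minimal among the finite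
graphs that fail the property. That is, `G` fails it, and every finite proper minor of `G`
(a minor that is not isomorphic to `G`) has it. -/
def IsExcludedMinorFInftyLE {V : Type u} (k : ℕ) (G : SimpleGraph V) : Prop :=
  ¬ G.fInfty ≤ k ∧
    ∀ (W : Type u) [Finite W] (H : SimpleGraph W),
      H.IsMinorOf G → IsEmpty (H ≃g G) → H.fInfty ≤ k

/-- The wheel `W_n` on `n + 1` vertices: the cycle on `Fin n` together with a hub `none` that is
adjacent to all vertices of the cycle. -/
def wheelGraph (n : ℕ) : SimpleGraph (Option (Fin n)) where
  Adj
    | none, none => False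
    | none, some _ => True
    | some _, none => True
    | some i, some j => (cycleGraph n).Adj i j
  symm := ⟨by
    rintro (_ | i) (_ | j) h
    · exact h
    · trivial
    · trivial
    · exact (show (cycleGraph n).Adj i j from h).symm⟩
  loopless := ⟨by
    rintro (_ | i) h
    · exact h
    · exact (cycleGraph n).irrefl h⟩

/-- `K₄ +ₑ K₄`: the complete graphs on `{0, 1, 2, 3}` and on `{0, 1, 4, 5}`, which share the edge
`e = {0, 1}`, with that edge deleted. -/
def twoSumK4K4 : SimpleGraph (Fin 6) where
  Adj i j := i ≠ j ∧
    ((i ∈ ({0, 1, 2, 3} : Finset (Fin 6)) ∧ j ∈ ({0, 1, 2, 3} : Finset (Fin 6))) ∨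
      (i ∈ ({0, 1, 4, 5} : Finset (Fin 6)) ∧ j ∈ ({0, 1, 4, 5} : Finset (Fin 6)))) ∧
    s(i, j) ≠ s(0, 1)
  symm := ⟨by decide⟩
  loopless := ⟨fun _ h => h.1 rfl⟩

end SimpleGraph

/-!
Each of the two graphs has explicit edge lengths, taken from dimension three, that do not occur in
the plane: every edge length has to be realized by one of the two coordinates with one of two signs,
and all choices contradict the triangle inequality in some coordinate
(`not_ellInftyRealizable_wheelGraph`, `not_ellInftyRealizable_twoSumK4K4`). When an edge of one of
the graphs is deleted or contracted, what remains is a subgraph of a graph that arises from `K₄` by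
repeatedly attaching a new vertex to the two ends of an edge. All such graphs are realizable in the
plane: any four points embed (`exists_four_points`), and if the distance of two vertices is right,
a third one can be placed at any two distances that satisfy the triangle inequalities
(`exists_point`). A third coordinate, the distance from a suitable vertex, accommodates the two
graphs themselves (`exists_realizes_three`).

Conversely, let `G` be an excluded minor. Separations of order at most one do not exist, since plane
realizations of the two sides could be glued by a translation
(`IsExcludedMinorFInftyLE.sepOrderGE_two`).

Suppose that `{a, b}` separates `G` into sides `A` and `B`. For a side `A`, either there are
disjoint connected sets `P ∋ a`, `Q ∋ b`, `S`, `T` in `A ∪ {a, b}` such that all pairs except `P`, `Q` are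
joined by an edge, or the placement of `a` and `b` in the plane, at the right distance, always
extends to `A` (`SepOrderGE.rootedModel_or_extends`). The dichotomy comes from Menger's theorem for
two paths (`exists_disjoint_links`), applied inside a connected `A` to the neighbours of `a` and
those of `b`. Two disjoint connections provide `S` and `T`; a separating vertex `w` can be placed by
the triangle inequality, and then divides `A` into two smaller parts, with roots `a`, `w` and
`b`, `w`. Extendability of `A` is impossible, because the rest of `G` with the added edge `ab` is a
proper minor, whose plane realization would extend to `G`. So both sides contain rooted models, and
their union is a model of `K₄ +ₑ K₄`.

If all separations of `G` have order at least three, then `G` has at least five vertices because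
four points embed in the plane. By Thomassen's lemma
(`SepOrderGE.exists_contractible_edge`) edges can be contracted, keeping this property, until five
vertices are left; the resulting graph lacks at most two disjoint edges of `K₅` and so contains the
wheel (`SepOrderGE.hasModel_wheelGraph`).
-/

namespace SimpleGraph

/-! ### Connected vertex sets -/

/-- A vertex set `s` is connected in `G`, in cut form: whenever `s` is divided into two nonempty
parts, some edge of `G` joins the parts. The empty set counts as connected. -/
def CutConnected {V : Type u} (G : SimpleGraph V) (s : Set V) : Prop :=
  ∀ t ⊆ s, t.Nonempty → (s \ t).Nonempty → ∃ a ∈ t, ∃ b ∈ s \ t, G.Adj a b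

variable {V : Type u} {W : Type v} {G G' : SimpleGraph V}

theorem cutConnected_of_subsingleton {s : Set V} (hs : s.Subsingleton) : G.CutConnected s := by
  rintro t hts ⟨a, ha⟩ ⟨b, hb, hbt⟩
  exact absurd (hs (hts ha) hb ▸ ha) hbt

theorem CutConnected.mono {s : Set V} (h : G.CutConnected s) (hle : G ≤ G') :
    G'.CutConnected s := fun t hts h1 h2 => by
  obtain ⟨a, ha, b, hb, hab⟩ := h t hts h1 h2
  exact ⟨a, ha, b, hb, hle hab⟩

/-- To check connectedness, it suffices to consider the parts that avoid a given vertex `p`. -/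
theorem cutConnected_of_forall_notMem {s : Set V} (p : V)
    (h : ∀ t ⊆ s, t.Nonempty → p ∉ t → (s \ t).Nonempty → ∃ a ∈ t, ∃ b ∈ s \ t, G.Adj a b) :
    G.CutConnected s := by
  intro t hts h1 h2
  by_cases hp : p ∈ t
  · obtain ⟨a, ha, b, hb, hab⟩ := h (s \ t) Set.sdiff_subset h2 (fun hh => hh.2 hp)
      (by rwa [Set.sdiff_sdiff_cancel_left hts])
    rw [Set.sdiff_sdiff_cancel_left hts] at hb
    exact ⟨b, hb, a, ha, hab.symm⟩
  · exact h t hts h1 hp h2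

theorem CutConnected.union {s t : Set V} (hs : G.CutConnected s) (ht : G.CutConnected t)
    {p : V} (hps : p ∈ s) (hpt : p ∈ t) : G.CutConnected (s ∪ t) := by
  refine cutConnected_of_forall_notMem p fun r hr ⟨x, hx⟩ hpr _ => ?_
  rcases hr hx with h | h
  · obtain ⟨a, ha, b, hb, hab⟩ := hs (r ∩ s) Set.inter_subset_right ⟨x, hx, h⟩
      ⟨p, hps, fun hh => hpr hh.1⟩
    exact ⟨a, ha.1, b, ⟨Or.inl hb.1, fun hh => hb.2 ⟨hh, hb.1⟩⟩, hab⟩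
  · obtain ⟨a, ha, b, hb, hab⟩ := ht (r ∩ t) Set.inter_subset_right ⟨x, hx, h⟩
      ⟨p, hpt, fun hh => hpr hh.1⟩
    exact ⟨a, ha.1, b, ⟨Or.inr hb.1, fun hh => hb.2 ⟨hh, hb.1⟩⟩, hab⟩

theorem cutConnected_pair {p q : V} (h : G.Adj p q) : G.CutConnected {p, q} := by
  refine cutConnected_of_forall_notMem p fun r hr ⟨x, hx⟩ hpr _ => ?_
  have hxq : x = q := (hr hx).resolve_left fun hh => hpr (hh ▸ hx)
  subst hxq
  exact ⟨x, hx, p, ⟨Or.inl rfl, hpr⟩, h.symm⟩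

theorem CutConnected.union_of_adj {s t : Set V} (hs : G.CutConnected s) (ht : G.CutConnected t)
    {p q : V} (hps : p ∈ s) (hqt : q ∈ t) (h : G.Adj p q) : G.CutConnected (s ∪ t) := by
  have h1 := (hs.union (cutConnected_pair h) hps (Or.inl rfl)).union ht
    (Or.inr (Or.inr rfl)) hqt
  convert h1 using 1
  ext x
  simp only [Set.mem_union, Set.mem_insert_iff, Set.mem_singleton_iff]
  constructor
  · tauto
  · rintro ((h | rfl | rfl) | h) <;> tauto

theorem CutConnected.insert_of_adj {s : Set V} (hs : G.CutConnected s)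
    {p q : V} (hps : p ∈ s) (h : G.Adj q p) : G.CutConnected (insert q s) :=
  (cutConnected_of_subsingleton Set.subsingleton_singleton).union_of_adj hs
    (Set.mem_singleton q) hps h

/-- Two disjoint connected sets inside a connected set can be enlarged until an edge joins them. -/
theorem CutConnected.exists_adj_of_disjoint [Finite V] {A S T : Set V} (hA : G.CutConnected A)
    (hSA : S ⊆ A) (hTA : T ⊆ A) (hS : G.CutConnected S)
    (hS0 : S.Nonempty) (hT0 : T.Nonempty) (hST : Disjoint S T) :
    ∃ S', S ⊆ S' ∧ S' ⊆ A ∧ G.CutConnected S' ∧ Disjoint S' T ∧ ∃ a ∈ S', ∃ b ∈ T, G.Adj a b := by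
  have hfin : {S' : Set V | S ⊆ S' ∧ S' ⊆ A ∧ G.CutConnected S' ∧ Disjoint S' T}.Finite :=
    Set.toFinite _
  obtain ⟨M, ⟨h1, h2, h3, h4⟩, hM⟩ := hfin.exists_maximal ⟨S, subset_rfl, hSA, hS, hST⟩
  refine ⟨M, h1, h2, h3, h4, ?_⟩
  obtain ⟨t, ht⟩ := hT0
  obtain ⟨a, ha, b, hb, hab⟩ := hA M h2 (hS0.mono h1) ⟨t, hTA ht, fun hh => h4.ne_of_mem hh ht rfl⟩
  by_cases hbT : b ∈ T
  · exact ⟨a, ha, b, hbT, hab⟩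
  · have : insert b M ⊆ M := hM ⟨h1.trans (Set.subset_insert _ _), Set.insert_subset hb.1 h2,
      h3.insert_of_adj ha hab.symm, Set.disjoint_insert_left.2 ⟨hbT, h4⟩⟩ (Set.subset_insert _ _)
    exact absurd (this (Set.mem_insert b M)) hb.2

/-! ### Two disjoint connections -/

/-- Some connected set that avoids `w` meets both `X` and `Y`, that is, `w` does not separate `X`
from `Y`. -/
def LinkedAvoiding (G : SimpleGraph V) (X Y : Set V) (w : V) : Prop :=
  ∃ L, G.CutConnected L ∧ (L ∩ X).Nonempty ∧ (L ∩ Y).Nonempty ∧ w ∉ L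

/-- The vertices that a connected set avoiding `w` joins to `X`. -/
def reach (G : SimpleGraph V) (X : Set V) (w : V) : Set V :=
  {v | ∃ L, G.CutConnected L ∧ (L ∩ X).Nonempty ∧ v ∈ L ∧ w ∉ L}

theorem LinkedAvoiding.symm {X Y : Set V} {w : V} (h : G.LinkedAvoiding X Y w) :
    G.LinkedAvoiding Y X w := by
  obtain ⟨L, h1, h2, h3, h4⟩ := h
  exact ⟨L, h1, h3, h2, h4⟩

theorem linkedAvoiding_iff {X Y : Set V} {w : V} :
    G.LinkedAvoiding X Y w ↔ (G.reach X w ∩ Y).Nonempty := by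
  constructor
  · rintro ⟨L, h1, h2, ⟨y, hy, hyY⟩, h4⟩
    exact ⟨y, ⟨L, h1, h2, hy, h4⟩, hyY⟩
  · rintro ⟨y, ⟨L, h1, h2, hy, h4⟩, hyY⟩
    exact ⟨L, h1, h2, ⟨y, hy, hyY⟩, h4⟩

theorem notMem_reach {X : Set V} {w : V} : w ∉ G.reach X w := fun ⟨_, _, _, h, h'⟩ => h' h

theorem mem_reach_of_mem {X : Set V} {w v : V} (hv : v ∈ X) (hw : v ≠ w) : v ∈ G.reach X w :=
  ⟨{v}, cutConnected_of_subsingleton Set.subsingleton_singleton, ⟨v, rfl, hv⟩, rfl, hw.symm⟩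

theorem mem_reach_of_adj {X : Set V} {w a b : V} (ha : a ∈ G.reach X w) (hab : G.Adj a b)
    (hb : b ≠ w) : b ∈ G.reach X w := by
  obtain ⟨L, h1, ⟨x, h2, h2'⟩, h3, h4⟩ := ha
  refine ⟨insert b L, h1.insert_of_adj h3 hab.symm, ⟨x, Or.inr h2, h2'⟩, Or.inl rfl, ?_⟩
  rintro (h | h)
  exacts [hb h.symm, h4 h]

theorem disjoint_reach {X Y : Set V} {w : V} (h : ¬ G.LinkedAvoiding X Y w) :
    Disjoint (G.reach X w) (G.reach Y w) := by
  rw [Set.disjoint_left]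
  rintro v ⟨L, h1, ⟨x, h2, h2'⟩, h3, h4⟩ ⟨M, k1, ⟨y, k2, k2'⟩, k3, k4⟩
  exact h ⟨L ∪ M, h1.union k1 h3 k3, ⟨x, Or.inl h2, h2'⟩, ⟨y, Or.inr k2, k2'⟩,
    fun hh => hh.elim h4 k4⟩

/-- A connected set through `s` can be trimmed to what `s` separates on the side of `X`. -/
theorem CutConnected.trim {S X : Set V} {s : V} (hS : G.CutConnected S) (hs : s ∈ S) :
    G.CutConnected (insert s (S ∩ G.reach X s)) := by
  refine cutConnected_of_forall_notMem s fun t ht h1 hst _ => ?_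
  have htS : ∀ x ∈ t, x ∈ S ∧ x ∈ G.reach X s := fun x hx =>
    (ht hx).resolve_left fun h => hst (h ▸ hx)
  obtain ⟨a, ha, b, hb, hab⟩ := hS t (fun x hx => (htS x hx).1) h1 ⟨s, hs, hst⟩
  refine ⟨a, ha, b, ⟨?_, hb.2⟩, hab⟩
  by_cases hbs : b = s
  · exact Or.inl hbs
  · exact Or.inr ⟨hb.1, mem_reach_of_adj (htS a ha).2 hab hbs⟩

/-- If `s` separates `X` from `Y` in `G - xy` and `x` lies on the side of `X`, then a vertex that
separates `X` from `{s, x}` in `G - xy` separates `X` from `Y` in `G`. -/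
theorem LinkedAvoiding.of_deleteEdges {X Y : Set V} {s x y : V}
    (hG : ∀ w, G.LinkedAvoiding X Y w)
    (hsep : ¬ (G.deleteEdges {s(x, y)}).LinkedAvoiding X Y s)
    (hx : x ∈ (G.deleteEdges {s(x, y)}).reach X s)
    (hy : y ∉ (G.deleteEdges {s(x, y)}).reach X s) (w : V) :
    (G.deleteEdges {s(x, y)}).LinkedAvoiding X {s, x} w := by
  set G' := G.deleteEdges {s(x, y)} with hG'
  by_contra hno
  have hno' : ∀ v ∈ G'.reach X w, v ≠ s ∧ v ≠ x := by
    intro v hv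
    rw [linkedAvoiding_iff] at hno
    constructor <;> rintro rfl <;> exact hno ⟨_, hv, by simp⟩
  have hws : w ≠ s := by
    rintro rfl
    exact (hno' x hx).2 rfl
  -- a set witnessing reachability that avoids `w` also avoids `s`
  have hsub : ∀ v ∈ G'.reach X w, v ∈ G'.reach X s := by
    rintro v ⟨L, h1, ⟨p, h2, h2'⟩, h3, h4⟩
    exact ⟨L, h1, ⟨p, h2, h2'⟩, h3, fun hs => (hno' s ⟨L, h1, ⟨p, h2, h2'⟩, hs, h4⟩).1 rfl⟩
  obtain ⟨L, h1, ⟨p, hpL, hpX⟩, ⟨q, hqL, hqY⟩, hwL⟩ := hG w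
  have hpw : p ≠ w := fun h => hwL (h ▸ hpL)
  obtain ⟨a, ha, b, hb, hab⟩ := h1 (L ∩ G'.reach X w) Set.inter_subset_left
    ⟨p, hpL, mem_reach_of_mem hpX hpw⟩
    ⟨q, hqL, fun hh => hsep (linkedAvoiding_iff.2 ⟨q, hsub q hh.2, hqY⟩)⟩
  have hbR : b ∉ G'.reach X w := fun hh => hb.2 ⟨hb.1, hh⟩
  have hbw : b ≠ w := fun h => hwL (h ▸ hb.1)
  have hnadj : ¬ G'.Adj a b := fun h => hbR (mem_reach_of_adj ha.2 h hbw)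
  rw [hG', deleteEdges_adj, not_and, not_not, Set.mem_singleton_iff, Sym2.eq_iff] at hnadj
  rcases hnadj hab with ⟨rfl, rfl⟩ | ⟨rfl, rfl⟩
  · exact (hno' a ha.2).2 rfl
  · exact hy (hsub a ha.2)

/-- The case of two paths of Menger's theorem, for connected sets in place of paths. The proof is
Göring's: if deleting an edge `xy` creates a separating vertex `s`, then two disjoint connections
from `X` to `{s, x}` and two from `{s, y}` to `Y` are glued along `s` and along `xy`. -/
theorem exists_disjoint_links [Finite V] (G : SimpleGraph V) :
    ∀ X Y : Set V, (∀ w, G.LinkedAvoiding X Y w) → (X ∪ Y).Nonempty →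
    ∃ S T, G.CutConnected S ∧ G.CutConnected T ∧ Disjoint S T ∧ (S ∩ X).Nonempty ∧
      (S ∩ Y).Nonempty ∧ (T ∩ X).Nonempty ∧ (T ∩ Y).Nonempty := by
  induction G using WellFoundedLT.induction with
  | ind G ih =>
  intro X Y hG hne
  by_cases hE : ∃ x y, G.Adj x y
  · obtain ⟨x, y, hxy⟩ := hE
    have key : ∀ x y s, G.Adj x y → (¬ (G.deleteEdges {s(x, y)}).LinkedAvoiding X Y s) →
        x ∈ (G.deleteEdges {s(x, y)}).reach X s → y ∈ (G.deleteEdges {s(x, y)}).reach Y s →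
        ∃ S T, G.CutConnected S ∧ G.CutConnected T ∧ Disjoint S T ∧ (S ∩ X).Nonempty ∧
          (S ∩ Y).Nonempty ∧ (T ∩ X).Nonempty ∧ (T ∩ Y).Nonempty := by
      clear hxy x y
      intro x y s hxy hs hx hy
      have hle : G.deleteEdges {s(x, y)} ≤ G := deleteEdges_le _
      have hlt : G.deleteEdges {s(x, y)} < G := by
        refine lt_of_le_of_ne hle fun h => ?_
        have h2 : (G.deleteEdges {s(x, y)}).Adj x y := h.symm ▸ hxy
        rw [deleteEdges_adj] at h2
        exact h2.2 rfl
      have hdis := disjoint_reach hs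
      have hX := LinkedAvoiding.of_deleteEdges hG hs hx (fun h => hdis.ne_of_mem h hy rfl)
      have hY := LinkedAvoiding.of_deleteEdges (x := y) (y := x) (s := s) (fun w => (hG w).symm)
        (by rw [Sym2.eq_swap]; exact fun h => hs h.symm) (by rwa [Sym2.eq_swap])
        (by rw [Sym2.eq_swap]; exact fun h => hdis.ne_of_mem hx h rfl)
      rw [Sym2.eq_swap] at hY
      set G' := G.deleteEdges {s(x, y)} with hG'
      have hxs : x ≠ s := fun h => notMem_reach (h ▸ hx)
      have hys : y ≠ s := fun h => notMem_reach (h ▸ hy)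
      -- one of two disjoint connections to `{s, x}` ends in `s`, the other in `x`
      have split : ∀ (X : Set V) (x : V), x ≠ s → (∀ w, G'.LinkedAvoiding X {s, x} w) →
          ∃ S T, G'.CutConnected S ∧ G'.CutConnected T ∧ Disjoint S T ∧ (S ∩ X).Nonempty ∧
            s ∈ S ∧ x ∈ T ∧ (T ∩ X).Nonempty ∧ S ⊆ insert s (G'.reach X s) ∧
            T ⊆ G'.reach X s := by
        intro X x hxs h
        obtain ⟨S, T, h1, h2, h3, h4, ⟨p, hp, hp'⟩, h6, ⟨q, hq, hq'⟩⟩ :=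
          ih G' hlt X {s, x} h ⟨s, by simp⟩
        have fin : ∀ S T, G'.CutConnected S → G'.CutConnected T → Disjoint S T →
            (S ∩ X).Nonempty → (T ∩ X).Nonempty → s ∈ S → x ∈ T →
            ∃ S T, G'.CutConnected S ∧ G'.CutConnected T ∧ Disjoint S T ∧ (S ∩ X).Nonempty ∧
            s ∈ S ∧ x ∈ T ∧ (T ∩ X).Nonempty ∧ S ⊆ insert s (G'.reach X s) ∧
            T ⊆ G'.reach X s := by
          intro S T h1 h2 h3 h4 h6 hs hx
          refine ⟨insert s (S ∩ G'.reach X s), T, h1.trim hs, h2, ?_, ?_, Or.inl rfl, hx, h6,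
            Set.insert_subset_insert Set.inter_subset_right,
            fun v hv => ⟨T, h2, h6, hv, fun hh => h3.ne_of_mem hs hh rfl⟩⟩
          · exact h3.mono_left (Set.insert_subset hs Set.inter_subset_left)
          · obtain ⟨z, hz, hzX⟩ := h4
            by_cases hzs : z = s
            · exact ⟨z, Or.inl hzs, hzX⟩
            · exact ⟨z, Or.inr ⟨hz, mem_reach_of_mem hzX hzs⟩, hzX⟩
        rcases hp' with rfl | hp'
        · rcases hq' with rfl | hq'
          · exact absurd rfl (h3.ne_of_mem hp hq)
          · rw [Set.mem_singleton_iff] at hq'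
            exact fin S T h1 h2 h3 h4 h6 hp (hq' ▸ hq)
        · rw [Set.mem_singleton_iff] at hp'
          rcases hq' with rfl | hq'
          · exact fin T S h2 h1 h3.symm h6 h4 hq (hp' ▸ hp)
          · rw [Set.mem_singleton_iff] at hq'
            exact absurd (hp'.trans hq'.symm) (h3.ne_of_mem hp hq)
      obtain ⟨S, T, a1, a2, a3, ⟨p, a4, a4'⟩, a5, a6, ⟨q, a7, a7'⟩, a8, a9⟩ := split X x hxs hX
      obtain ⟨S', T', b1, b2, b3, ⟨p', b4, b4'⟩, b5, b6, ⟨q', b7, b7'⟩, b8, b9⟩ :=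
        split Y y hys hY
      refine ⟨S ∪ S', T ∪ T', (a1.mono hle).union (b1.mono hle) a5 b5,
        (a2.mono hle).union_of_adj (b2.mono hle) a6 b6 hxy, ?_, ⟨p, Or.inl a4, a4'⟩,
        ⟨p', Or.inr b4, b4'⟩, ⟨q, Or.inl a7, a7'⟩, ⟨q', Or.inr b7, b7'⟩⟩
      rw [Set.disjoint_union_left, Set.disjoint_union_right, Set.disjoint_union_right]
      refine ⟨⟨a3, ?_⟩, ?_, b3⟩
      · refine Set.disjoint_of_subset a8 b9 (Set.disjoint_insert_left.2 ⟨notMem_reach, hdis⟩)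
      · refine Set.disjoint_of_subset b8 a9 (Set.disjoint_insert_left.2 ⟨notMem_reach, hdis.symm⟩)
    by_cases hall : ∀ w, (G.deleteEdges {s(x, y)}).LinkedAvoiding X Y w
    · have hle : G.deleteEdges {s(x, y)} ≤ G := deleteEdges_le _
      have hlt : G.deleteEdges {s(x, y)} < G := by
        refine lt_of_le_of_ne hle fun h => ?_
        have h2 : (G.deleteEdges {s(x, y)}).Adj x y := h.symm ▸ hxy
        rw [deleteEdges_adj] at h2
        exact h2.2 rfl
      obtain ⟨S, T, h1, h2, h3⟩ := ih _ hlt X Y hall hne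
      exact ⟨S, T, h1.mono hle, h2.mono hle, h3⟩
    · push Not at hall
      obtain ⟨s, hs⟩ := hall
      set G' := G.deleteEdges {s(x, y)} with hG'
      have hdis := disjoint_reach hs
      -- a connection in `G` that avoids `s` leaves the side of `X`, and likewise the side of `Y`,
      -- through the edge `xy`
      obtain ⟨L, h1, ⟨p, hp, hpX⟩, ⟨q, hq, hqY⟩, hsL⟩ := hG s
      have cross : ∀ (Z : Set V) (p q : V), p ∈ L → p ∈ Z → q ∈ L → q ∉ G'.reach Z s →
          (x ∈ G'.reach Z s ∧ y ∉ G'.reach Z s) ∨ (y ∈ G'.reach Z s ∧ x ∉ G'.reach Z s) := by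
        intro Z p q hp hpZ hq hqZ
        obtain ⟨a, ha, b, hb, hab⟩ := h1 (L ∩ G'.reach Z s) Set.inter_subset_left
          ⟨p, hp, mem_reach_of_mem hpZ fun h => hsL (h ▸ hp)⟩ ⟨q, hq, fun hh => hqZ hh.2⟩
        have hbR : b ∉ G'.reach Z s := fun hh => hb.2 ⟨hb.1, hh⟩
        have hnadj : ¬ G'.Adj a b := fun h =>
          hbR (mem_reach_of_adj ha.2 h fun h => hsL (h ▸ hb.1))
        rw [hG', deleteEdges_adj, not_and, not_not, Set.mem_singleton_iff, Sym2.eq_iff] at hnadj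
        rcases hnadj hab with ⟨rfl, rfl⟩ | ⟨rfl, rfl⟩
        · exact Or.inl ⟨ha.2, hbR⟩
        · exact Or.inr ⟨ha.2, hbR⟩
      have hpR : p ∈ G'.reach X s := mem_reach_of_mem hpX fun h => hsL (h ▸ hp)
      have hqR : q ∈ G'.reach Y s := mem_reach_of_mem hqY fun h => hsL (h ▸ hq)
      have c1 := cross X p q hp hpX hq fun h => hdis.ne_of_mem h hqR rfl
      have c2 := cross Y q p hq hqY hp fun h => hdis.ne_of_mem hpR h rfl
      rcases c1 with ⟨c1, c1'⟩ | ⟨c1, c1'⟩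
      · rcases c2 with ⟨c2, -⟩ | ⟨c2, -⟩
        · exact absurd rfl (hdis.ne_of_mem c1 c2)
        · exact key x y s hxy hs c1 c2
      · rcases c2 with ⟨c2, -⟩ | ⟨c2, -⟩
        · rw [hG', Sym2.eq_swap] at hs c1 c2
          exact key y x s hxy.symm hs c1 c2
        · exact absurd rfl (hdis.ne_of_mem c1 c2)
  · push Not at hE
    -- without edges, connected sets have at most one vertex
    have hsub : ∀ L, G.CutConnected L → ∀ a ∈ L, ∀ b ∈ L, a = b := by
      intro L hL a ha b hb
      by_contra hab
      obtain ⟨c, -, d, -, hcd⟩ := hL {a} (by simpa using ha) ⟨a, rfl⟩ ⟨b, hb, fun h => hab h.symm⟩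
      exact hE c d hcd
    obtain ⟨z, -⟩ := hne
    obtain ⟨L, h1, h2, h3, -⟩ := hG z
    obtain ⟨p, hp⟩ := h2
    obtain ⟨M, k1, k2, k3, k4⟩ := hG p
    refine ⟨L, M, h1, k1, Set.disjoint_left.2 fun v hv hv' => ?_, ⟨p, hp⟩, h3, k2, k3⟩
    exact k4 (hsub L h1 p hp.1 v hv ▸ hv')

/-! ### Minors and branch sets -/

/-- `G` has a model of `H`: disjoint nonempty connected branch sets in `G`, one for each vertex of
`H`, such that an edge of `G` joins the branch sets of any two adjacent vertices of `H`. -/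
def HasModel (H : SimpleGraph W) (G : SimpleGraph V) : Prop :=
  ∃ S : W → Set V, (∀ w, (S w).Nonempty) ∧ (∀ w, G.CutConnected (S w)) ∧
    (∀ w w', w ≠ w' → Disjoint (S w) (S w')) ∧
    ∀ w w', H.Adj w w' → ∃ a ∈ S w, ∃ b ∈ S w', G.Adj a b

/-- Connectedness of a set `s` in cut form gives reachability in any graph `C` on a set of vertices,
embedded by `f`, that contains the edges of `G` inside `s`. -/
theorem CutConnected.reachable {s : Set V} (h : G.CutConnected s) {T : Type*} (C : SimpleGraph T)
    (f : T → V) (hf : Function.Injective f) (hs : s ⊆ Set.range f)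
    (hC : ∀ x y, f x ∈ s → f y ∈ s → G.Adj (f x) (f y) → C.Adj x y) {x y : T}
    (hx : f x ∈ s) (hy : f y ∈ s) : C.Reachable x y := by
  by_contra hxy
  obtain ⟨a, ⟨ha, x', rfl, hx'⟩, b, ⟨hb, hb'⟩, hab⟩ := h
    {v | v ∈ s ∧ ∃ z, f z = v ∧ C.Reachable x z} (fun v hv => hv.1) ⟨f x, hx, x, rfl, Reachable.refl _⟩
    ⟨f y, hy, fun ⟨_, z, hz, hz'⟩ => hxy (hf hz ▸ hz')⟩
  obtain ⟨z, rfl⟩ := hs hb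
  exact hb' ⟨hb, z, rfl, hx'.trans (hC _ _ ha hb hab).reachable⟩

theorem HasModel.isMinorOf {H : SimpleGraph W} (h : H.HasModel G) : H.IsMinorOf G := by
  classical
  obtain ⟨S, hne, hconn, hdis, hadj⟩ := h
  have huniq : ∀ w w' v, v ∈ S w → v ∈ S w' → w = w' := fun w w' v h h' => by
    by_contra hww
    exact (hdis w w' hww).ne_of_mem h h' rfl
  let K : G.Subgraph :=
    { verts := {v | ∃ w, v ∈ S w}
      Adj := fun a b => G.Adj a b ∧ ∃ w w', a ∈ S w ∧ b ∈ S w' ∧ (w = w' ∨ H.Adj w w')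
      adj_sub := fun h => h.1
      edge_vert := fun ⟨_, w, _, hw, _⟩ => ⟨w, hw⟩
      symm := ⟨fun a b ⟨h, w, w', hw, hw', hh⟩ =>
        ⟨h.symm, w', w, hw', hw, hh.imp Eq.symm fun h => h.symm⟩⟩ }
  let C : SimpleGraph K.verts :=
    { Adj := fun a b => G.Adj a b ∧ ∃ w, (a : V) ∈ S w ∧ (b : V) ∈ S w
      symm := ⟨fun a b ⟨h, w, hw, hw'⟩ => ⟨h.symm, w, hw', hw⟩⟩
      loopless := ⟨fun a h => G.irrefl h.1⟩ }
  let φ : K.verts → W := fun v => v.2.choose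
  have hφ : ∀ v : K.verts, (v : V) ∈ S (φ v) := fun v => v.2.choose_spec
  have hφ' : ∀ (v : K.verts) w, (v : V) ∈ S w → φ v = w := fun v w hw => huniq _ _ _ (hφ v) hw
  have hCφ : ∀ x y, C.Adj x y → φ x = φ y := by
    rintro x y ⟨-, w, hx, hy⟩
    rw [hφ' x w hx, hφ' y w hy]
  have hreach : ∀ x y, C.Reachable x y → φ x = φ y := by
    rintro x y ⟨p⟩
    induction p with
    | nil => rfl
    | cons h p ih => exact (hCφ _ _ h).trans ih
  have hreach' : ∀ x y, φ x = φ y → C.Reachable x y := by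
    intro x y hxy
    refine (hconn (φ x)).reachable C Subtype.val Subtype.val_injective ?_ ?_ (hφ x)
      (hxy ▸ hφ y)
    · intro v hv
      exact ⟨⟨v, φ x, hv⟩, rfl⟩
    · intro a b ha hb hab
      exact ⟨hab, φ x, ha, hb⟩
  let ψ : C.ConnectedComponent → W := fun c => φ c.out
  have hout : ∀ c : C.ConnectedComponent, C.connectedComponentMk c.out = c := fun c =>
    Quot.out_eq c
  have hψ : ∀ x, ψ (C.connectedComponentMk x) = φ x := fun x =>
    hreach _ _ (ConnectedComponent.exact (hout _))
  have hbij : Function.Bijective ψ := by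
    constructor
    · intro c d hcd
      rw [← hout c, ← hout d]
      exact ConnectedComponent.sound (hreach' _ _ hcd)
    · intro w
      obtain ⟨v, hv⟩ := hne w
      exact ⟨C.connectedComponentMk ⟨v, w, hv⟩, (hψ _).trans (hφ' _ _ hv)⟩
  refine ⟨K, C, ?_, ⟨RelIso.symm ⟨Equiv.ofBijective ψ hbij, ?_⟩⟩⟩
  · rintro a b ⟨h, w, hw, hw'⟩
    exact ⟨h, w, w, hw, hw', Or.inl rfl⟩
  · intro c d
    change H.Adj (ψ c) (ψ d) ↔ c ≠ d ∧ _
    constructor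
    · intro h
      refine ⟨fun hcd => H.irrefl (hcd ▸ h), ?_⟩
      obtain ⟨a, ha, b, hb, hab⟩ := hadj _ _ h
      refine ⟨⟨a, _, ha⟩, ⟨b, _, hb⟩, hbij.1 ?_, hbij.1 ?_, hab, _, _, ha, hb, Or.inr h⟩
      · rw [hψ, hφ' _ _ ha]
      · rw [hψ, hφ' _ _ hb]
    · rintro ⟨hne, x, y, rfl, rfl, -, w, w', hw, hw', hww⟩
      rw [hψ, hψ, hφ' _ _ hw, hφ' _ _ hw']
      refine hww.resolve_left fun h => hne ?_
      apply hbij.1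
      rw [hψ, hψ, hφ' _ _ hw, hφ' _ _ hw', h]

/-- Contracting along a map with connected fibres reflects connectedness of vertex sets. -/
theorem CutConnected.preimage {f : V → W} (hfib : ∀ w, G.CutConnected (f ⁻¹' {w})) {s : Set W}
    (hs : (G.map f).CutConnected s) : G.CutConnected (f ⁻¹' s) := by
  intro t hts ⟨x, hx⟩ ⟨y, hy, hyt⟩
  by_cases hsplit : ∃ a ∈ t, ∃ b ∉ t, f a = f b
  · obtain ⟨a, ha, b, hb, hab⟩ := hsplit
    obtain ⟨c, hc, d, hd, hcd⟩ := hfib (f a) (t ∩ f ⁻¹' {f a}) Set.inter_subset_right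
      ⟨a, ha, rfl⟩ ⟨b, hab.symm, fun hh => hb hh.1⟩
    refine ⟨c, hc.1, d, ⟨?_, fun hh => hd.2 ⟨hh, hd.1⟩⟩, hcd⟩
    have h1 : f d = f a := hd.1
    have h2 : f a ∈ s := hts ha
    change f d ∈ s
    rwa [h1]
  · push Not at hsplit
    obtain ⟨_, ⟨a, ha, rfl⟩, d, ⟨hd, hd'⟩, -, c, e, hce, hc, rfl⟩ := hs (f '' t)
      (by rintro _ ⟨a, ha, rfl⟩; exact hts ha) ⟨f x, x, hx, rfl⟩
      ⟨f y, hy, fun ⟨a, ha, hay⟩ => hsplit a ha y hyt hay⟩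
    have hct : c ∈ t := by
      by_contra hct
      exact hsplit a ha c hct hc.symm
    exact ⟨c, hct, e, ⟨hd, fun he => hd' ⟨e, he, rfl⟩⟩, hce⟩

theorem HasModel.of_map {U : Type*} {H : SimpleGraph U} {f : V → W} (hf : Function.Surjective f)
    (hfib : ∀ w, G.CutConnected (f ⁻¹' {w})) (h : H.HasModel (G.map f)) : H.HasModel G := by
  obtain ⟨S, hne, hconn, hdis, hadj⟩ := h
  refine ⟨fun w => f ⁻¹' S w, fun w => ?_, fun w => (hconn w).preimage hfib,
    fun w w' hw => (hdis w w' hw).preimage f, fun w w' hw => ?_⟩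
  · obtain ⟨x, hx⟩ := hne w
    obtain ⟨y, rfl⟩ := hf x
    exact ⟨y, hx⟩
  · obtain ⟨_, ha, _, hb, -, a, b, hab, rfl, rfl⟩ := hadj w w' hw
    exact ⟨a, ha, b, hb, hab⟩

theorem HasModel.of_iso_left {U : Type*} {H : SimpleGraph U} {H' : SimpleGraph W} (e : H' ≃g H)
    (h : H.HasModel G) : H'.HasModel G := by
  obtain ⟨S, hne, hconn, hdis, hadj⟩ := h
  exact ⟨fun w => S (e w), fun w => hne _, fun w => hconn _,
    fun w w' hw => hdis _ _ fun hh => hw (e.injective hh),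
    fun w w' hw => hadj _ _ (e.map_adj_iff.2 hw)⟩

/-- A copy of `H` as a subgraph of `G` is a model with singleton branch sets. -/
theorem HasModel.of_injective {H : SimpleGraph W} (f : W → V) (hf : Function.Injective f)
    (h : ∀ a b, H.Adj a b → G.Adj (f a) (f b)) : H.HasModel G :=
  ⟨fun w => {f w}, fun _ => Set.singleton_nonempty _,
    fun _ => cutConnected_of_subsingleton Set.subsingleton_singleton,
    fun w w' hw => by simpa using fun hh => hw (hf hh),
    fun w w' hw => ⟨f w, rfl, f w', rfl, h _ _ hw⟩⟩

/-! ### Realizability -/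

/-- `q` reproduces the edge lengths of `r`. -/
def Realizes (G : SimpleGraph V) {m k : ℕ} (r : V → Fin m → ℝ) (q : V → Fin k → ℝ) : Prop :=
  ∀ x y, G.Adj x y → ‖r x - r y‖ = ‖q x - q y‖

theorem ellInftyRealizable_mono {k l : ℕ} (hkl : k ≤ l) (h : G.EllInftyRealizable k) :
    G.EllInftyRealizable l := by
  intro m r
  obtain ⟨q, hq⟩ := h m r
  refine ⟨fun v i => if hi : i.val < k then q v ⟨i, hi⟩ else 0, fun x y hxy => ?_⟩
  rw [hq x y hxy]
  apply le_antisymm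
  · refine (pi_norm_le_iff_of_nonneg (norm_nonneg _)).2 fun i => ?_
    have := norm_le_pi_norm ((fun i : Fin l => if hi : i.val < k then q x ⟨i, hi⟩ else 0) -
      (fun i : Fin l => if hi : i.val < k then q y ⟨i, hi⟩ else 0)) ⟨i, i.2.trans_le hkl⟩
    simpa using this
  · refine (pi_norm_le_iff_of_nonneg (norm_nonneg _)).2 fun i => ?_
    by_cases hi : i.val < k
    · have := norm_le_pi_norm (q x - q y) ⟨i, hi⟩
      simpa [hi] using this
    · simp [hi]

theorem fInfty_le_iff {k : ℕ} : G.fInfty ≤ k ↔ G.EllInftyRealizable k := by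
  constructor
  · intro h
    by_contra hno
    have : ((k + 1 : ℕ) : ℕ∞) ≤ G.fInfty := by
      refine le_iInf₂ fun l hl => ?_
      have : k < l := by
        by_contra hlk
        exact hno (ellInftyRealizable_mono (not_lt.1 hlk) hl)
      exact_mod_cast this
    have h2 := this.trans h
    norm_cast at h2
    omega
  · intro h
    exact iInf₂_le k h

theorem fInfty_eq_three (h2 : ¬ G.EllInftyRealizable 2) (h3 : G.EllInftyRealizable 3) :
    G.fInfty = 3 := by
  apply le_antisymm
  · exact_mod_cast fInfty_le_iff.2 h3
  · by_contra h
    apply h2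
    rw [← fInfty_le_iff]
    exact Order.le_of_lt_add_one (by simpa using lt_of_lt_of_eq (not_le.1 h) (by norm_num))

theorem EllInftyRealizable.of_iso {H : SimpleGraph W} (e : H ≃g G) {k : ℕ}
    (h : G.EllInftyRealizable k) : H.EllInftyRealizable k := by
  intro m r
  obtain ⟨q, hq⟩ := h m fun v => r (e.symm v)
  refine ⟨fun w => q (e w), fun x y hxy => ?_⟩
  simpa using hq (e x) (e y) (e.map_adj_iff.2 hxy)

/-- Vectors for a minor `H` of `G` are spread over `G`: they are constant on the contracted
components and zero outside the subgraph. If the edge lengths that arise can always be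
reproduced in `ℝᵏ` on the edges of the subgraph, then `H` is realizable in `ℝᵏ`. -/
theorem ellInftyRealizable_of_contractEdges {H : SimpleGraph W} {k : ℕ} (S : G.Subgraph)
    (C : SimpleGraph S.verts) (hC : C ≤ S.coe) (e : H ≃g S.coe.contractEdges C)
    (h : ∀ (m : ℕ) (r : V → Fin m → ℝ), (∀ x y, C.Adj x y → r x = r y) →
      ∃ q : V → Fin k → ℝ, ∀ x y, S.Adj x y → ‖r x - r y‖ = ‖q x - q y‖) :
    H.EllInftyRealizable k := by
  classical
  intro m r
  let r' : V → Fin m → ℝ := fun v =>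
    if hv : v ∈ S.verts then r (e.symm (C.connectedComponentMk ⟨v, hv⟩)) else 0
  have hr' : ∀ v : S.verts, r' v = r (e.symm (C.connectedComponentMk v)) := fun v => by
    simp only [r', v.2, dif_pos, Subtype.coe_eta]
  obtain ⟨q, hq⟩ := h m r' fun x y hxy => by
    rw [hr', hr', ConnectedComponent.sound hxy.reachable]
  have hconst : ∀ x y, C.Reachable x y → q x = q y := by
    rintro x y ⟨p⟩
    induction p with
    | nil => rfl
    | @cons a b c hab p ih =>
      refine Eq.trans ?_ ih
      have h1 := hq a b (hC hab)
      rw [hr', hr', ConnectedComponent.sound hab.reachable, sub_self, norm_zero] at h1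
      exact sub_eq_zero.1 (norm_eq_zero.1 h1.symm)
  have hout : ∀ x, q ((C.connectedComponentMk x).out : S.verts) = q x := fun x =>
    hconst _ _ (ConnectedComponent.exact (Quot.out_eq _))
  refine ⟨fun w => q ((e w).out : S.verts), fun x y hxy => ?_⟩
  obtain ⟨-, a, b, ha, hb, hab⟩ := e.map_adj_iff.2 hxy
  have h1 := hq a b hab
  rw [hr', hr', ha, hb, e.symm_apply_apply, e.symm_apply_apply] at h1
  have hx : q ((e x).out : S.verts) = q a := ha ▸ hout a
  have hy : q ((e y).out : S.verts) = q b := hb ▸ hout b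
  exact h1.trans (congrArg norm (congrArg₂ (· - ·) hx.symm hy.symm))

/-- `G` becomes realizable in `ℝᵏ` when the edge `xy` is deleted or contracted, where contraction
is expressed by considering only vectors that agree at `x` and `y`. -/
def EdgeCriticalAt (G : SimpleGraph V) (k : ℕ) (x y : V) : Prop :=
  ∀ (m : ℕ) (r : V → Fin m → ℝ),
    (∃ q : V → Fin k → ℝ, (G.deleteEdges {s(x, y)}).Realizes r q) ∧
    (r x = r y → ∃ q : V → Fin k → ℝ, G.Realizes r q)

theorem EdgeCriticalAt.symm {k : ℕ} {x y : V} (h : G.EdgeCriticalAt k x y) :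
    G.EdgeCriticalAt k y x := by
  intro m r
  rw [Sym2.eq_swap]
  exact ⟨(h m r).1, fun hr => (h m r).2 hr.symm⟩

theorem EdgeCriticalAt.map {H : SimpleGraph W} {k : ℕ} {x y : V} (h : G.EdgeCriticalAt k x y)
    (e : G ≃g H) : H.EdgeCriticalAt k (e x) (e y) := by
  intro m r
  obtain ⟨⟨q, hq⟩, h2⟩ := h m fun v => r (e v)
  refine ⟨⟨fun w => q (e.symm w), fun a b hab => ?_⟩, fun hr => ?_⟩
  · rw [deleteEdges_adj] at hab
    have := hq (e.symm a) (e.symm b) (by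
      rw [deleteEdges_adj]
      refine ⟨e.symm.map_adj_iff.2 hab.1, fun h => hab.2 ?_⟩
      have h' : s(e.symm a, e.symm b) = s(x, y) := h
      have h2 := congrArg (Sym2.map e) h'
      simpa using h2)
    simpa using this
  · obtain ⟨q, hq⟩ := h2 hr
    exact ⟨fun w => q (e.symm w), fun a b hab => by
      simpa using hq (e.symm a) (e.symm b) (e.symm.map_adj_iff.2 hab)⟩

/-- `G` has no isolated vertices and becomes realizable in `ℝᵏ` when any edge is deleted or
contracted. Isolated vertices are excluded so that deleting a vertex deletes an edge. -/
def EdgeCritical (G : SimpleGraph V) (k : ℕ) : Prop :=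
  (∀ x, ∃ y, G.Adj x y) ∧ ∀ x y, G.Adj x y → G.EdgeCriticalAt k x y

theorem EdgeCritical.of_iso {H : SimpleGraph W} (e : H ≃g G) {k : ℕ}
    (h : G.EdgeCritical k) : H.EdgeCritical k := by
  refine ⟨fun x => ?_, fun x y hxy => ?_⟩
  · obtain ⟨y, hy⟩ := h.1 (e x)
    exact ⟨e.symm y, by rw [← e.map_adj_iff]; simpa using hy⟩
  · simpa using (h.2 (e x) (e y) (e.map_adj_iff.2 hxy)).map e.symm

theorem EdgeCritical.realizable_of_isMinorOf {H : SimpleGraph W} {k : ℕ} (h : G.EdgeCritical k)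
    (hH : H.IsMinorOf G) (hne : IsEmpty (H ≃g G)) : H.EllInftyRealizable k := by
  obtain ⟨S, C, hC, ⟨e⟩⟩ := hH
  by_cases h1 : ∃ x y, G.Adj x y ∧ ¬ S.Adj x y
  · obtain ⟨x, y, hxy, hS⟩ := h1
    refine ellInftyRealizable_of_contractEdges S C hC e fun m r _ => ?_
    obtain ⟨⟨q, hq⟩, -⟩ := h.2 x y hxy m r
    refine ⟨q, fun a b hab => hq a b ?_⟩
    rw [deleteEdges_adj]
    refine ⟨hab.adj_sub, fun hh => hS ?_⟩
    rcases Sym2.eq_iff.1 (Set.mem_singleton_iff.1 hh) with ⟨rfl, rfl⟩ | ⟨rfl, rfl⟩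
    exacts [hab, hab.symm]
  by_cases h2 : ∃ x y, C.Adj x y
  · obtain ⟨x, y, hxy⟩ := h2
    refine ellInftyRealizable_of_contractEdges S C hC e fun m r hr => ?_
    obtain ⟨q, hq⟩ := (h.2 x y (hC hxy).adj_sub m r).2 (hr x y hxy)
    exact ⟨q, fun a b hab => hq a b hab.adj_sub⟩
  -- nothing is deleted and nothing is contracted
  push Not at h1 h2
  have hverts : ∀ v, v ∈ S.verts := fun v => by
    obtain ⟨y, hy⟩ := h.1 v
    exact (h1 v y hy).fst_mem
  have hCr : ∀ x y, C.Reachable x y → x = y := by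
    rintro x y ⟨p⟩
    cases p with
    | nil => rfl
    | cons h _ => exact absurd h (h2 _ _)
  let f : V → C.ConnectedComponent := fun v => C.connectedComponentMk ⟨v, hverts v⟩
  have hf : Function.Bijective f := by
    constructor
    · intro a b hab
      exact congrArg Subtype.val (hCr _ _ (ConnectedComponent.exact hab))
    · intro c
      exact ⟨c.out, Quot.out_eq c⟩
  have iso : G ≃g S.coe.contractEdges C := by
    refine ⟨Equiv.ofBijective f hf, ?_⟩
    intro a b
    change (f a ≠ f b ∧ _) ↔ _
    constructor
    · rintro ⟨-, x, y, hx, hy, hxy⟩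
      have hx' := congrArg Subtype.val (hCr _ _ (ConnectedComponent.exact hx))
      have hy' := congrArg Subtype.val (hCr _ _ (ConnectedComponent.exact hy))
      simp only at hx' hy'
      have h3 := hxy.adj_sub
      rwa [hx', hy'] at h3
    · intro hab
      exact ⟨fun hh => hab.ne (hf.1 hh), ⟨a, hverts a⟩, ⟨b, hverts b⟩, rfl, rfl, h1 a b hab⟩
  exact (hne.false (e.trans iso.symm)).elim

theorem EdgeCritical.isExcludedMinor {k : ℕ} (h : G.EdgeCritical k)
    (hG : ¬ G.EllInftyRealizable k) : G.IsExcludedMinorFInftyLE k :=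
  ⟨fun hh => hG (fInfty_le_iff.1 hh), fun _ _ _ hH hne =>
    fInfty_le_iff.2 (h.realizable_of_isMinorOf hH hne)⟩

/-! ### Distances in the plane with the maximum norm -/

theorem norm_fin_two_eq_iff (v : Fin 2 → ℝ) (d : ℝ) :
    ‖v‖ = d ↔ |v 0| ≤ d ∧ |v 1| ≤ d ∧ (|v 0| = d ∨ |v 1| = d) := by
  have h : ‖v‖ = max |v 0| |v 1| := by
    apply le_antisymm
    · refine (pi_norm_le_iff_of_nonneg (le_max_of_le_left (abs_nonneg _))).2 fun i => ?_
      fin_cases i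
      · exact le_max_left _ _
      · exact le_max_right _ _
    · exact max_le (norm_le_pi_norm v 0) (norm_le_pi_norm v 1)
  rw [h]
  constructor
  · rintro rfl
    refine ⟨le_max_left _ _, le_max_right _ _, ?_⟩
    rcases max_choice |v 0| |v 1| with h | h
    · exact Or.inl h.symm
    · exact Or.inr h.symm
  · rintro ⟨h0, h1, h2 | h2⟩
    · rw [← h2, max_eq_left]
      rwa [h2]
    · rw [← h2, max_eq_right]
      rwa [h2]

theorem norm_pair_sub_eq {a b c d D : ℝ} (h0 : |a - c| ≤ D) (h1 : |b - d| ≤ D)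
    (h : |a - c| = D ∨ |b - d| = D) : D = ‖(![a, b] : Fin 2 → ℝ) - ![c, d]‖ :=
  Eq.symm <| (norm_fin_two_eq_iff _ _).2 (by simpa using ⟨h0, h1, h⟩)

/-- Two points at distance `d` with `|s - t| ≤ d ≤ s + t`: some point has distance `s` from the
first and `t` from the second. In a coordinate that realizes `d`, the new point is placed between
the two points or in line with them, so that `t ≥ s` is realized there; the other coordinate is
free to realize `s`. -/
theorem exists_point_of_le {a b : Fin 2 → ℝ} {s t : ℝ} (hst : s ≤ t) (hs : 0 ≤ s)
    (h1 : t ≤ ‖a - b‖ + s) (h2 : ‖a - b‖ ≤ s + t) :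
    ∃ c : Fin 2 → ℝ, ‖c - a‖ = s ∧ ‖c - b‖ = t := by
  have other : ∀ x y d : ℝ, |x - y| ≤ d → d ≤ s + t → ∃ z, |z - x| = s ∧ |z - y| ≤ t := by
    intro x y d h h'
    rcases abs_le.1 h with ⟨h3, h4⟩
    rcases le_total x y with hxy | hxy
    · refine ⟨x + s, by rw [add_sub_cancel_left, abs_of_nonneg hs], abs_le.2 ⟨?_, ?_⟩⟩ <;> linarith
    · refine ⟨x - s, ?_, abs_le.2 ⟨?_, ?_⟩⟩
      · rw [sub_sub_cancel_left, abs_neg, abs_of_nonneg hs]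
      · linarith
      · linarith
  have tight : ∀ x y d : ℝ, |x - y| = d → d ≤ s + t → t ≤ d + s →
      ∃ z, |z - x| ≤ s ∧ |z - y| = t := by
    intro x y d h h' h''
    rcases abs_cases (x - y) with ⟨h3, h4⟩ | ⟨h3, h4⟩
    · refine ⟨y + t, abs_le.2 ⟨?_, ?_⟩, ?_⟩
      · linarith
      · linarith
      · rw [add_sub_cancel_left, abs_of_nonneg (hs.trans hst)]
    · refine ⟨y - t, abs_le.2 ⟨?_, ?_⟩, ?_⟩
      · linarith
      · linarith
      · rw [sub_sub_cancel_left, abs_neg, abs_of_nonneg (hs.trans hst)]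
  obtain ⟨k0, k1, k2⟩ := (norm_fin_two_eq_iff (a - b) _).1 rfl
  simp only [Pi.sub_apply] at k0 k1 k2
  rcases k2 with k2 | k2
  · obtain ⟨z, hz, hz'⟩ := tight _ _ _ k2 h2 h1
    obtain ⟨w, hw, hw'⟩ := other _ _ _ k1 h2
    refine ⟨![z, w], (norm_fin_two_eq_iff _ _).2 ?_, (norm_fin_two_eq_iff _ _).2 ?_⟩ <;>
      simp [*]
  · obtain ⟨z, hz, hz'⟩ := tight _ _ _ k2 h2 h1
    obtain ⟨w, hw, hw'⟩ := other _ _ _ k0 h2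
    refine ⟨![w, z], (norm_fin_two_eq_iff _ _).2 ?_, (norm_fin_two_eq_iff _ _).2 ?_⟩ <;>
      simp [*]

theorem exists_point {a b : Fin 2 → ℝ} {s t : ℝ} (hs : 0 ≤ s) (ht : 0 ≤ t)
    (h1 : t ≤ ‖a - b‖ + s) (h2 : s ≤ ‖a - b‖ + t) (h3 : ‖a - b‖ ≤ s + t) :
    ∃ c : Fin 2 → ℝ, ‖c - a‖ = s ∧ ‖c - b‖ = t := by
  rcases le_total s t with h | h
  · exact exists_point_of_le h hs h1 h3
  · obtain ⟨c, h4, h5⟩ := exists_point_of_le (a := b) (b := a) h ht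
      (by rwa [norm_sub_rev]) (by rw [norm_sub_rev]; linarith)
    exact ⟨c, h5, h4⟩

/-- A vertex `v` can be attached to two vertices whose distance is already reproduced. -/
theorem exists_update_vertex {m : ℕ} (r : V → Fin m → ℝ) (q : V → Fin 2 → ℝ) {v a b : V}
    (hva : v ≠ a) (hvb : v ≠ b) (h : ‖r a - r b‖ = ‖q a - q b‖) :
    ∃ q' : V → Fin 2 → ℝ, (∀ x, x ≠ v → q' x = q x) ∧ ‖r v - r a‖ = ‖q' v - q' a‖ ∧
      ‖r v - r b‖ = ‖q' v - q' b‖ := by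
  classical
  have e1 : r v - r b = (r a - r b) + (r v - r a) := by abel
  have e2 : r v - r a = -(r a - r b) + (r v - r b) := by abel
  have e3 : r a - r b = -(r v - r a) + (r v - r b) := by abel
  obtain ⟨c, h1, h2⟩ := exists_point (a := q a) (b := q b) (norm_nonneg (r v - r a))
    (norm_nonneg (r v - r b))
    (by rw [← h]; conv_lhs => rw [e1]
        exact norm_add_le _ _)
    (by rw [← h]; conv_lhs => rw [e2]
        exact (norm_add_le _ _).trans_eq (by rw [norm_neg]))
    (by rw [← h]; conv_lhs => rw [e3]
        exact (norm_add_le _ _).trans_eq (by rw [norm_neg]))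
  refine ⟨Function.update q v c, fun x hx => Function.update_of_ne hx _ _, ?_, ?_⟩
  · rw [Function.update_self, Function.update_of_ne hva.symm, h1]
  · rw [Function.update_self, Function.update_of_ne hvb.symm, h2]

/-- Four points with `ad + bc` the largest of the three sums of opposite distances: the
first coordinate realizes the distances along the path `a b c d`, the second one those along the
complementary path `c a d b`. -/
theorem exists_four_points_of_le {m : ℕ} (a b c d : Fin m → ℝ)
    (h1 : ‖a - b‖ + ‖c - d‖ ≤ ‖a - d‖ + ‖b - c‖) (h2 : ‖a - c‖ + ‖b - d‖ ≤ ‖a - d‖ + ‖b - c‖) :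
    ∃ a' b' c' d' : Fin 2 → ℝ, ‖a - b‖ = ‖a' - b'‖ ∧ ‖a - c‖ = ‖a' - c'‖ ∧ ‖a - d‖ = ‖a' - d'‖ ∧
      ‖b - c‖ = ‖b' - c'‖ ∧ ‖b - d‖ = ‖b' - d'‖ ∧ ‖c - d‖ = ‖c' - d'‖ := by
  have tri : ∀ x y z : Fin m → ℝ, ‖x - z‖ ≤ ‖x - y‖ + ‖y - z‖ := norm_sub_le_norm_sub_add_norm_sub
  have t1 := tri a b c
  have t2 := tri b a c
  have t3 := tri a c b
  have t4 := tri a b d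
  have t5 := tri b a d
  have t6 := tri a d b
  have t7 := tri a c d
  have t8 := tri c a d
  have t9 := tri a d c
  have t10 := tri b c d
  have t11 := tri c b d
  have t12 := tri b d c
  rw [norm_sub_rev b a] at t2 t5
  rw [norm_sub_rev c b] at t3 t11
  rw [norm_sub_rev d b] at t6
  rw [norm_sub_rev c a] at t8
  rw [norm_sub_rev d c] at t9 t12
  have p1 := norm_nonneg (a - b)
  have p2 := norm_nonneg (a - c)
  have p3 := norm_nonneg (a - d)
  have p4 := norm_nonneg (b - c)
  have p5 := norm_nonneg (b - d)
  have p6 := norm_nonneg (c - d)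
  generalize ‖a - b‖ = ab at *
  generalize ‖a - c‖ = ac at *
  generalize ‖a - d‖ = ad at *
  generalize ‖b - c‖ = bc at *
  generalize ‖b - d‖ = bd at *
  generalize ‖c - d‖ = cd at *
  have eq : ∀ x y D : ℝ, 0 ≤ D → x - y = D → |x - y| = D := fun x y D h h' => by
    rw [h', abs_of_nonneg h]
  have eq' : ∀ x y D : ℝ, 0 ≤ D → y - x = D → |x - y| = D := fun x y D h h' => by
    rw [abs_sub_comm, h', abs_of_nonneg h]
  refine ⟨![0, ac], ![ab, ac - ad + bd], ![ab - bc, 0], ![ab - bc + cd, ac - ad],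
    norm_pair_sub_eq (abs_le.2 ⟨?_, ?_⟩) (abs_le.2 ⟨?_, ?_⟩) (Or.inl (eq' _ _ _ p1 ?_)),
    norm_pair_sub_eq (abs_le.2 ⟨?_, ?_⟩) (abs_le.2 ⟨?_, ?_⟩) (Or.inr (eq _ _ _ p2 ?_)),
    norm_pair_sub_eq (abs_le.2 ⟨?_, ?_⟩) (abs_le.2 ⟨?_, ?_⟩) (Or.inr (eq _ _ _ p3 ?_)),
    norm_pair_sub_eq (abs_le.2 ⟨?_, ?_⟩) (abs_le.2 ⟨?_, ?_⟩) (Or.inl (eq _ _ _ p4 ?_)),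
    norm_pair_sub_eq (abs_le.2 ⟨?_, ?_⟩) (abs_le.2 ⟨?_, ?_⟩) (Or.inr (eq _ _ _ p5 ?_)),
    norm_pair_sub_eq (abs_le.2 ⟨?_, ?_⟩) (abs_le.2 ⟨?_, ?_⟩) (Or.inl (eq' _ _ _ p6 ?_))⟩ <;>
  linarith

theorem exists_four_points {m : ℕ} (p : Fin 4 → Fin m → ℝ) :
    ∃ q : Fin 4 → Fin 2 → ℝ, ∀ i j, ‖p i - p j‖ = ‖q i - q j‖ := by
  have build : ∀ a b c d : Fin 2 → ℝ, ‖p 0 - p 1‖ = ‖a - b‖ → ‖p 0 - p 2‖ = ‖a - c‖ →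
      ‖p 0 - p 3‖ = ‖a - d‖ → ‖p 1 - p 2‖ = ‖b - c‖ → ‖p 1 - p 3‖ = ‖b - d‖ →
      ‖p 2 - p 3‖ = ‖c - d‖ → ∃ q : Fin 4 → Fin 2 → ℝ, ∀ i j, ‖p i - p j‖ = ‖q i - q j‖ := by
    intro a b c d h1 h2 h3 h4 h5 h6
    refine ⟨![a, b, c, d], fun i j => ?_⟩
    have k1 := h1
    have k2 := h2
    have k3 := h3
    have k4 := h4
    have k5 := h5
    have k6 := h6
    rw [norm_sub_rev, norm_sub_rev a] at k1 k2 k3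
    rw [norm_sub_rev, norm_sub_rev b] at k4 k5
    rw [norm_sub_rev, norm_sub_rev c] at k6
    fin_cases i <;> fin_cases j <;>
      first
        | (simp; done) | exact h1 | exact h2 | exact h3 | exact h4 | exact h5 | exact h6
        | exact k1 | exact k2 | exact k3 | exact k4 | exact k5 | exact k6
  have hor : ∀ x y z : ℝ, (x ≤ z ∧ y ≤ z) ∨ (x ≤ y ∧ z ≤ y) ∨ (y ≤ x ∧ z ≤ x) := by
    intro x y z
    rcases le_total x y with h | h
    · rcases le_total y z with h' | h'
      · exact Or.inl ⟨h.trans h', h'⟩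
      · exact Or.inr (Or.inl ⟨h, h'⟩)
    · rcases le_total x z with h' | h'
      · exact Or.inl ⟨h', h.trans h'⟩
      · exact Or.inr (Or.inr ⟨h, h'⟩)
  rcases hor (‖p 0 - p 1‖ + ‖p 2 - p 3‖) (‖p 0 - p 2‖ + ‖p 1 - p 3‖)
    (‖p 0 - p 3‖ + ‖p 1 - p 2‖) with ⟨h1, h2⟩ | ⟨h1, h2⟩ | ⟨h1, h2⟩
  · obtain ⟨a, b, c, d, k⟩ := exists_four_points_of_le (p 0) (p 1) (p 2) (p 3) h1 h2
    obtain ⟨k1, k2, k3, k4, k5, k6⟩ := k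
    exact build a b c d k1 k2 k3 k4 k5 k6
  · -- exchange the last two points
    obtain ⟨a, b, d, c, k1, k2, k3, k4, k5, k6⟩ :=
      exists_four_points_of_le (p 0) (p 1) (p 3) (p 2)
        (by rw [norm_sub_rev (p 3)]; linarith) (by linarith)
    rw [norm_sub_rev, norm_sub_rev d] at k6
    exact build a b c d k1 k3 k2 k5 k4 k6
  · -- exchange the second and the last point
    obtain ⟨a, d, c, b, k1, k2, k3, k4, k5, k6⟩ :=
      exists_four_points_of_le (p 0) (p 3) (p 2) (p 1)
        (by rw [norm_sub_rev (p 2), norm_sub_rev (p 3)]; linarith)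
        (by rw [norm_sub_rev (p 3), norm_sub_rev (p 3)]; linarith)
    rw [norm_sub_rev, norm_sub_rev d] at k4 k5
    rw [norm_sub_rev, norm_sub_rev c] at k6
    exact build a b c d k3 k2 k1 k6 k5 k4

theorem exists_realizes_range {m : ℕ} (r : V → Fin m → ℝ) (f : Fin 4 → V)
    (hf : Function.Injective f) :
    ∃ q : V → Fin 2 → ℝ, ∀ i j, ‖r (f i) - r (f j)‖ = ‖q (f i) - q (f j)‖ := by
  obtain ⟨q, hq⟩ := exists_four_points fun i => r (f i)
  exact ⟨Function.extend f q 0, fun i j => by rw [hf.extend_apply, hf.extend_apply]; exact hq i j⟩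

theorem ellInftyRealizable_two_of_card_le [Finite V] (h : Nat.card V ≤ 4) :
    G.EllInftyRealizable 2 := by
  intro m r
  obtain ⟨f⟩ : Nonempty (V ↪ Fin 4) := by
    have := Fintype.ofFinite V
    rw [Function.Embedding.nonempty_iff_card_le, Fintype.card_fin, ← Nat.card_eq_fintype_card]
    exact h
  obtain ⟨q, hq⟩ := exists_four_points (Function.extend f r 0)
  refine ⟨fun v => q (f v), fun x y _ => ?_⟩
  rw [← hq, f.injective.extend_apply, f.injective.extend_apply]

/-- One further coordinate suffices for a further vertex `v`: the distance from `v`. The other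
coordinates of `v` only have to respect upper bounds, and they can be chosen since the distances
between the neighbours of `v` are reproduced. -/
theorem exists_realizes_three {m : ℕ} (r : V → Fin m → ℝ) (q : V → Fin 2 → ℝ) (v a b c : V)
    (hv : ∀ x, G.Adj v x → x = a ∨ x = b ∨ x = c)
    (hav : a ≠ v) (hbv : b ≠ v) (hcv : c ≠ v)
    (hab : ‖r a - r b‖ = ‖q a - q b‖) (hac : ‖r a - r c‖ = ‖q a - q c‖)
    (hbc : ‖r b - r c‖ = ‖q b - q c‖)
    (h : ∀ x y, x ≠ v → y ≠ v → G.Adj x y → ‖r x - r y‖ = ‖q x - q y‖) :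
    ∃ q' : V → Fin 3 → ℝ, G.Realizes r q' := by
  classical
  have hle : ∀ x y : V, ‖r x - r y‖ = ‖q x - q y‖ → ∀ i,
      q x i - ‖r x - r v‖ ≤ q y i + ‖r y - r v‖ ∧ q y i - ‖r y - r v‖ ≤ q x i + ‖r x - r v‖ := by
    intro x y hxy i
    have h1 : |q x i - q y i| ≤ ‖q x - q y‖ := norm_le_pi_norm (q x - q y) i
    have h2 := norm_sub_le_norm_sub_add_norm_sub (r x) (r v) (r y)
    rw [norm_sub_rev (r v)] at h2
    have := abs_le.1 h1
    constructor <;> linarith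
  have hdiag : ∀ x i, q x i - ‖r x - r v‖ ≤ q x i + ‖r x - r v‖ := fun x i => by
    linarith [norm_nonneg (r x - r v)]
  let qv : Fin 2 → ℝ := fun i =>
    max (q a i - ‖r a - r v‖) (max (q b i - ‖r b - r v‖) (q c i - ‖r c - r v‖))
  have hqv : ∀ x, (x = a ∨ x = b ∨ x = c) → ∀ i, |qv i - q x i| ≤ ‖r x - r v‖ := by
    intro x hx i
    have hlow : q x i - ‖r x - r v‖ ≤ qv i := by
      rcases hx with rfl | rfl | rfl
      · exact le_max_left _ _
      · exact le_max_of_le_right (le_max_left _ _)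
      · exact le_max_of_le_right (le_max_right _ _)
    have hup : qv i ≤ q x i + ‖r x - r v‖ := by
      rcases hx with rfl | rfl | rfl
      · exact max_le (hdiag _ _) (max_le (hle _ _ hab i).2 (hle _ _ hac i).2)
      · exact max_le (hle _ _ hab i).1 (max_le (hdiag _ _) (hle _ _ hbc i).2)
      · exact max_le (hle _ _ hac i).1 (max_le (hle _ _ hbc i).1 (hdiag _ _))
    exact abs_le.2 ⟨by linarith, by linarith⟩
  let q1 := Function.update q v qv
  have hcons : ∀ (s t D : ℝ) (x y : Fin 2 → ℝ), |s - t| ≤ D → (∀ i, |x i - y i| ≤ D) → 0 ≤ D →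
      (|s - t| = D ∨ ‖x - y‖ = D) →
      D = ‖(Fin.cons s x : Fin 3 → ℝ) - (Fin.cons t y : Fin 3 → ℝ)‖ := by
    intro s t D x y h1 h2 hD h3
    apply le_antisymm
    · rcases h3 with h3 | h3
      · rw [← h3]
        exact norm_le_pi_norm ((Fin.cons s x : Fin 3 → ℝ) - (Fin.cons t y : Fin 3 → ℝ)) 0
      · rw [← h3]
        refine (pi_norm_le_iff_of_nonneg (norm_nonneg _)).2 fun i => ?_
        exact norm_le_pi_norm ((Fin.cons s x : Fin 3 → ℝ) - (Fin.cons t y : Fin 3 → ℝ)) i.succ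
    · refine (pi_norm_le_iff_of_nonneg hD).2 fun i => ?_
      refine Fin.cases ?_ (fun j => ?_) i
      · exact h1
      · exact h2 j
  have hvx : ∀ x, G.Adj v x → ‖r v - r x‖ =
      ‖(Fin.cons ‖r v - r v‖ (q1 v) : Fin 3 → ℝ) - (Fin.cons ‖r x - r v‖ (q1 x) : Fin 3 → ℝ)‖ := by
    intro x hx
    have hxv : x ≠ v := hx.ne'
    have h1 : q1 v = qv := Function.update_self _ _ _
    have h2 : q1 x = q x := Function.update_of_ne hxv _ _
    have h3 : |‖r v - r v‖ - ‖r x - r v‖| = ‖r v - r x‖ := by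
      rw [sub_self, norm_zero, zero_sub, abs_neg, abs_norm, norm_sub_rev]
    refine hcons _ _ _ _ _ h3.le ?_ (norm_nonneg _) (Or.inl h3)
    rw [h1, h2, norm_sub_rev]
    exact hqv x (hv x hx)
  refine ⟨fun x => Fin.cons ‖r x - r v‖ (q1 x), fun x y hxy => ?_⟩
  by_cases hxv : x = v
  · subst hxv
    exact hvx y hxy
  by_cases hyv : y = v
  · subst hyv
    rw [norm_sub_rev, hvx x hxy.symm, norm_sub_rev]
  have h1 : q1 x = q x := Function.update_of_ne hxv _ _
  have h2 : q1 y = q y := Function.update_of_ne hyv _ _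
  have h3 := h x y hxv hyv hxy
  refine hcons _ _ _ _ _ ?_ ?_ (norm_nonneg _) (Or.inr (by rw [h1, h2, h3]))
  · have := abs_norm_sub_norm_le (r x - r v) (r y - r v)
    rwa [sub_sub_sub_cancel_right] at this
  · intro i
    rw [h1, h2, h3]
    exact norm_le_pi_norm (q x - q y) i

/-! ### The two graphs are not realizable in the plane -/

theorem norm_triple_sub_eq {a b c a' b' c' D : ℝ}
    (h : |a - a'| ≤ D ∧ |b - b'| ≤ D ∧ |c - c'| ≤ D)
    (h' : |a - a'| = D ∨ |b - b'| = D ∨ |c - c'| = D) :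
    ‖(![a, b, c] : Fin 3 → ℝ) - ![a', b', c']‖ = D := by
  have hD : 0 ≤ D := (abs_nonneg _).trans h.1
  apply le_antisymm
  · refine (pi_norm_le_iff_of_nonneg hD).2 fun i => ?_
    fin_cases i
    exacts [h.1, h.2.1, h.2.2]
  · rcases h' with h' | h' | h'
    · exact h'.ge.trans (norm_le_pi_norm ((![a, b, c] : Fin 3 → ℝ) - ![a', b', c']) 0)
    · exact h'.ge.trans (norm_le_pi_norm ((![a, b, c] : Fin 3 → ℝ) - ![a', b', c']) 1)
    · exact h'.ge.trans (norm_le_pi_norm ((![a, b, c] : Fin 3 → ℝ) - ![a', b', c']) 2)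

/-- The coordinates `x` and `y` respect the distance `D` between `i` and `j`, and one of them
realizes it. -/
def PlanarDist {ι : Type*} (x y : ι → ℝ) (i j : ι) (D : ℝ) : Prop :=
  |x i - x j| ≤ D ∧ |y i - y j| ≤ D ∧ (|x i - x j| = D ∨ |y i - y j| = D)

theorem planarDist_of_norm_eq {ι : Type*} {q : ι → Fin 2 → ℝ} {i j : ι} {D : ℝ}
    (h : ‖q i - q j‖ = D) : PlanarDist (fun i => q i 0) (fun i => q i 1) i j D :=
  (norm_fin_two_eq_iff _ _).1 h

theorem PlanarDist.swap {ι : Type*} {x y : ι → ℝ} {i j : ι} {D : ℝ} (h : PlanarDist x y i j D) :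
    PlanarDist y x i j D := ⟨h.2.1, h.1, h.2.2.symm⟩

theorem PlanarDist.neg {ι : Type*} {x y : ι → ℝ} {i j : ι} {D : ℝ} (h : PlanarDist x y i j D) :
    PlanarDist (fun i => - x i) y i j D := by
  have : |(- x i) - (- x j)| = |x i - x j| := by rw [neg_sub_neg, abs_sub_comm]
  unfold PlanarDist
  rw [this]
  exact h

theorem PlanarDist.cases {ι : Type*} {x y : ι → ℝ} {i j : ι} {D : ℝ} (h : PlanarDist x y i j D)
    (hD : 0 ≤ D) :
    (x i - x j ≤ D ∧ x j - x i ≤ D ∧ y i - y j ≤ D ∧ y j - y i ≤ D) ∧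
    (x i - x j = D ∨ x j - x i = D ∨ y i - y j = D ∨ y j - y i = D) := by
  obtain ⟨h1, h2, h3⟩ := h
  rw [abs_le] at h1 h2
  rw [abs_eq hD, abs_eq hD] at h3
  refine ⟨⟨h1.2, by linarith, h2.2, by linarith⟩, ?_⟩
  rcases h3 with (h3 | h3) | (h3 | h3)
  · exact Or.inl h3
  · exact Or.inr (Or.inl (by linarith))
  · exact Or.inr (Or.inr (Or.inl h3))
  · exact Or.inr (Or.inr (Or.inr (by linarith)))

set_option maxHeartbeats 2000000 in
/-- Edge lengths on the wheel that do not occur in the plane, under the normalization that the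
first coordinate realizes the spoke to `3` with a fixed sign. Each edge is realized by one of the
two coordinates with one of two signs; every combination of these choices violates the upper
bounds along some closed walk. -/
theorem not_planarDist_wheel_of_eq {x y : Option (Fin 4) → ℝ}
    (h1 : PlanarDist x y none (some 0) 4) (h2 : PlanarDist x y none (some 1) 3)
    (h3 : PlanarDist x y none (some 2) 3) (h4 : PlanarDist x y none (some 3) 4)
    (h12 : PlanarDist x y (some 0) (some 1) 3) (h23 : PlanarDist x y (some 1) (some 2) 4)
    (h34 : PlanarDist x y (some 2) (some 3) 3) (h41 : PlanarDist x y (some 3) (some 0) 3)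
    (h : x none - x (some 3) = 4) : False := by
  obtain ⟨⟨a1, a2, a3, a4⟩, t1⟩ := h1.cases (by norm_num)
  obtain ⟨⟨b1, b2, b3, b4⟩, t2⟩ := h2.cases (by norm_num)
  obtain ⟨⟨c1, c2, c3, c4⟩, t3⟩ := h3.cases (by norm_num)
  obtain ⟨⟨d1, d2, d3, d4⟩, -⟩ := h4.cases (by norm_num)
  obtain ⟨⟨e1, e2, e3, e4⟩, t12⟩ := h12.cases (by norm_num)
  obtain ⟨⟨f1, f2, f3, f4⟩, t23⟩ := h23.cases (by norm_num)
  obtain ⟨⟨g1, g2, g3, g4⟩, t34⟩ := h34.cases (by norm_num)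
  obtain ⟨⟨k1, k2, k3, k4⟩, t41⟩ := h41.cases (by norm_num)
  clear h1 h2 h3 h4 h12 h23 h34 h41
  rcases t34 with t34 | t34 | t34 | t34 <;> rcases t2 with t2 | t2 | t2 | t2 <;>
    first
    | (exfalso; linarith)
    | (rcases t41 with t41 | t41 | t41 | t41 <;> first
      | (exfalso; linarith)
      | (rcases t3 with t3 | t3 | t3 | t3 <;> first
        | (exfalso; linarith)
        | (rcases t23 with t23 | t23 | t23 | t23 <;> first
          | (exfalso; linarith)
          | (rcases t12 with t12 | t12 | t12 | t12 <;> first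
            | (exfalso; linarith)
            | (rcases t1 with t1 | t1 | t1 | t1 <;> linarith)))))

/-- The edge lengths of `not_planarDist_wheel_of_eq` occur in dimension three. -/
theorem not_ellInftyRealizable_wheelGraph : ¬ (wheelGraph 4).EllInftyRealizable 2 := by
  intro h
  let r : Option (Fin 4) → Fin 3 → ℝ
    | none => ![0, 4, 3]
    | some 0 => ![4, 0, 6]
    | some 1 => ![3, 3, 4]
    | some 2 => ![3, 6, 0]
    | some 3 => ![4, 3, 3]
  obtain ⟨q, hq⟩ := h 3 r
  have key : ∀ a b D, (wheelGraph 4).Adj a b → ‖r a - r b‖ = D →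
      PlanarDist (fun i => q i 0) (fun i => q i 1) a b D := fun a b D hab hD =>
    planarDist_of_norm_eq ((hq a b hab).symm.trans hD)
  have h1 := key none (some 0) 4 trivial
    (norm_triple_sub_eq (by norm_num [abs_le]) (by norm_num))
  have h2 := key none (some 1) 3 trivial
    (norm_triple_sub_eq (by norm_num [abs_le]) (by norm_num))
  have h3 := key none (some 2) 3 trivial
    (norm_triple_sub_eq (by norm_num [abs_le]) (by norm_num))
  have h4 := key none (some 3) 4 trivial
    (norm_triple_sub_eq (by norm_num [abs_le]) (by norm_num))
  have h12 := key (some 0) (some 1) 3 (show (cycleGraph 4).Adj 0 1 by decide)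
    (norm_triple_sub_eq (by norm_num [abs_le]) (by norm_num))
  have h23 := key (some 1) (some 2) 4 (show (cycleGraph 4).Adj 1 2 by decide)
    (norm_triple_sub_eq (by norm_num [abs_le]) (by norm_num))
  have h34 := key (some 2) (some 3) 3 (show (cycleGraph 4).Adj 2 3 by decide)
    (norm_triple_sub_eq (by norm_num [abs_le]) (by norm_num))
  have h41 := key (some 3) (some 0) 3 (show (cycleGraph 4).Adj 3 0 by decide)
    (norm_triple_sub_eq (by norm_num [abs_le]) (by norm_num))
  rcases (h4.cases (by norm_num)).2 with t | t | t | t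
  · exact not_planarDist_wheel_of_eq h1 h2 h3 h4 h12 h23 h34 h41 t
  · exact not_planarDist_wheel_of_eq h1.neg h2.neg h3.neg h4.neg h12.neg h23.neg h34.neg h41.neg
      (by linarith)
  · exact not_planarDist_wheel_of_eq h1.swap h2.swap h3.swap h4.swap h12.swap h23.swap h34.swap
      h41.swap t
  · exact not_planarDist_wheel_of_eq h1.swap.neg h2.swap.neg h3.swap.neg h4.swap.neg h12.swap.neg
      h23.swap.neg h34.swap.neg h41.swap.neg (by linarith)

/-- Edge lengths from dimension three that do not occur in the plane. -/
theorem not_ellInftyRealizable_twoSumK4K4 : ¬ twoSumK4K4.EllInftyRealizable 2 := by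
  intro h
  let r : Fin 6 → Fin 3 → ℝ
    | 0 => ![0, 2, 2]
    | 1 => ![2, 0, 1]
    | 2 => ![3, 1, 0]
    | 3 => ![1, 3, 3]
    | 4 => ![1, 1, 2]
    | 5 => ![2, 1, 0]
  obtain ⟨q, hq⟩ := h 3 r
  have key : ∀ a b D, twoSumK4K4.Adj a b → ‖r a - r b‖ = D → 0 ≤ D → _ := fun a b D hab hD h0 =>
    (planarDist_of_norm_eq ((hq a b hab).symm.trans hD)).cases h0
  obtain ⟨⟨a1, a2, a3, a4⟩, t02⟩ := key 0 2 3 (by unfold twoSumK4K4; decide)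
    (norm_triple_sub_eq (by norm_num [abs_le]) (by norm_num))
    (by norm_num)
  obtain ⟨⟨b1, b2, b3, b4⟩, -⟩ := key 0 3 1 (by unfold twoSumK4K4; decide)
    (norm_triple_sub_eq (by norm_num [abs_le]) (by norm_num))
    (by norm_num)
  obtain ⟨⟨c1, c2, c3, c4⟩, -⟩ := key 1 2 1 (by unfold twoSumK4K4; decide)
    (norm_triple_sub_eq (by norm_num [abs_le]) (by norm_num))
    (by norm_num)
  obtain ⟨⟨d1, d2, d3, d4⟩, t13⟩ := key 1 3 3 (by unfold twoSumK4K4; decide)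
    (norm_triple_sub_eq (by norm_num [abs_le]) (by norm_num))
    (by norm_num)
  obtain ⟨⟨e1, e2, e3, e4⟩, -⟩ := key 2 3 3 (by unfold twoSumK4K4; decide)
    (norm_triple_sub_eq (by norm_num [abs_le]) (by norm_num))
    (by norm_num)
  obtain ⟨⟨f1, f2, f3, f4⟩, -⟩ := key 0 4 1 (by unfold twoSumK4K4; decide)
    (norm_triple_sub_eq (by norm_num [abs_le]) (by norm_num))
    (by norm_num)
  obtain ⟨⟨g1, g2, g3, g4⟩, -⟩ := key 0 5 2 (by unfold twoSumK4K4; decide)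
    (norm_triple_sub_eq (by norm_num [abs_le]) (by norm_num))
    (by norm_num)
  obtain ⟨⟨k1, k2, k3, k4⟩, -⟩ := key 1 4 1 (by unfold twoSumK4K4; decide)
    (norm_triple_sub_eq (by norm_num [abs_le]) (by norm_num))
    (by norm_num)
  obtain ⟨⟨l1, l2, l3, l4⟩, -⟩ := key 1 5 1 (by unfold twoSumK4K4; decide)
    (norm_triple_sub_eq (by norm_num [abs_le]) (by norm_num))
    (by norm_num)
  obtain ⟨⟨m1, m2, m3, m4⟩, t45⟩ := key 4 5 2 (by unfold twoSumK4K4; decide)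
    (norm_triple_sub_eq (by norm_num [abs_le]) (by norm_num))
    (by norm_num)
  -- no choice of coordinates and signs for the three edges `02`, `45`, `13` is consistent
  rcases t02 with t02 | t02 | t02 | t02 <;> rcases t45 with t45 | t45 | t45 | t45 <;>
    first
    | (exfalso; linarith)
    | (rcases t13 with t13 | t13 | t13 | t13 <;> linarith)

/-! ### The two graphs are critical and have parameter three -/

/-- A symmetric relation holds along all edges of the wheel if it holds along the four spokes and
the four edges of the rim. -/
theorem forall_adj_wheelGraph {P : Option (Fin 4) → Option (Fin 4) → Prop}
    (hs : ∀ x y, P x y → P y x) (h1 : ∀ i, P none (some i))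
    (h2 : ∀ i : Fin 4, P (some i) (some (i + 1))) :
    ∀ x y, (wheelGraph 4).Adj x y → P x y
  | none, none, h => h.elim
  | none, some i, _ => h1 i
  | some i, none, _ => hs _ _ (h1 i)
  | some i, some j, h => by
    have h' : (cycleGraph 4).Adj i j := h
    have : j = i + 1 ∨ i = j + 1 := by
      clear h
      revert i j
      decide
    rcases this with rfl | rfl
    · exact h2 i
    · exact hs _ _ (h2 j)

/-- The rotation of the wheel. -/
def wheelRotation : wheelGraph 4 ≃g wheelGraph 4 where
  toEquiv := Equiv.optionCongr (Equiv.addRight 1)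
  map_rel_iff' := by
    rintro (_ | i) (_ | j)
    · exact Iff.rfl
    · exact Iff.rfl
    · exact Iff.rfl
    · change (cycleGraph 4).Adj (i + 1) (j + 1) ↔ (cycleGraph 4).Adj i j
      revert i j
      decide

/-- Without the spoke to `0`, the vertex `0` is attached to its two neighbours on the rim, whose
distance is reproduced along with those of the other vertices. -/
theorem edgeCriticalAt_wheelGraph_spoke :
    (wheelGraph 4).EdgeCriticalAt 2 none (some 0) := by
  intro m r
  obtain ⟨q, hq⟩ := exists_realizes_range r ![none, some 1, some 2, some 3] (by decide)
  constructor
  · obtain ⟨q', h1, h2, h3⟩ := exists_update_vertex r q (v := some 0) (a := some 1) (b := some 3)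
      (by decide) (by decide) (hq 1 3)
    have hrest : ∀ x y, x ≠ some 0 → y ≠ some 0 → ‖r x - r y‖ = ‖q x - q y‖ →
        ‖r x - r y‖ = ‖q' x - q' y‖ := fun x y hx hy h => by rw [h1 x hx, h1 y hy, h]
    refine ⟨q', fun x y hxy => ?_⟩
    rw [deleteEdges_adj] at hxy
    revert hxy
    rw [and_imp]
    revert x y
    refine forall_adj_wheelGraph (fun x y h hxy => ?_) (fun i => ?_) (fun i => ?_)
    · rw [norm_sub_rev, norm_sub_rev (q' y)]
      exact h fun hh => hxy (Sym2.eq_swap.trans hh)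
    · intro h
      fin_cases i
      · exact absurd rfl h
      · exact hrest _ _ (by decide) (by decide) (hq 0 1)
      · exact hrest _ _ (by decide) (by decide) (hq 0 2)
      · exact hrest _ _ (by decide) (by decide) (hq 0 3)
    · intro _
      fin_cases i
      · exact h2
      · exact hrest _ _ (by decide) (by decide) (hq 1 2)
      · exact hrest _ _ (by decide) (by decide) (hq 2 3)
      · rw [norm_sub_rev, norm_sub_rev (q' _)]
        exact h3
  · intro hr
    refine ⟨fun x => if x = some 0 then q none else q x, forall_adj_wheelGraph (fun x y h => ?_)
      (fun i => ?_) (fun i => ?_)⟩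
    · rw [norm_sub_rev, h, norm_sub_rev]
    · fin_cases i
      · simp [hr]
      · exact hq 0 1
      · exact hq 0 2
      · exact hq 0 3
    · fin_cases i
      · change ‖r (some 0) - r (some 1)‖ = ‖q none - q (some 1)‖
        rw [← hr]
        exact hq 0 1
      · exact hq 1 2
      · exact hq 2 3
      · change ‖r (some 3) - r (some 0)‖ = ‖q (some 3) - q none‖
        rw [← hr]
        exact hq 3 0

/-- Without the rim edge `01`, the vertex `0` is attached to the hub and to `3`. -/
theorem edgeCriticalAt_wheelGraph_rim :
    (wheelGraph 4).EdgeCriticalAt 2 (some 0) (some 1) := by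
  intro m r
  obtain ⟨q, hq⟩ := exists_realizes_range r ![none, some 1, some 2, some 3] (by decide)
  constructor
  · obtain ⟨q', h1, h2, h3⟩ := exists_update_vertex r q (v := some 0) (a := none) (b := some 3)
      (by decide) (by decide) (hq 0 3)
    have hrest : ∀ x y, x ≠ some 0 → y ≠ some 0 → ‖r x - r y‖ = ‖q x - q y‖ →
        ‖r x - r y‖ = ‖q' x - q' y‖ := fun x y hx hy h => by rw [h1 x hx, h1 y hy, h]
    refine ⟨q', fun x y hxy => ?_⟩
    rw [deleteEdges_adj] at hxy
    revert hxy
    rw [and_imp]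
    revert x y
    refine forall_adj_wheelGraph (fun x y h hxy => ?_) (fun i => ?_) (fun i => ?_)
    · rw [norm_sub_rev, norm_sub_rev (q' y)]
      exact h fun hh => hxy (Sym2.eq_swap.trans hh)
    · intro _
      fin_cases i
      · rw [norm_sub_rev, norm_sub_rev (q' _)]
        exact h2
      · exact hrest _ _ (by decide) (by decide) (hq 0 1)
      · exact hrest _ _ (by decide) (by decide) (hq 0 2)
      · exact hrest _ _ (by decide) (by decide) (hq 0 3)
    · intro h
      fin_cases i
      · exact absurd rfl h
      · exact hrest _ _ (by decide) (by decide) (hq 1 2)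
      · exact hrest _ _ (by decide) (by decide) (hq 2 3)
      · rw [norm_sub_rev, norm_sub_rev (q' _)]
        exact h3
  · intro hr
    refine ⟨fun x => if x = some 0 then q (some 1) else q x,
      forall_adj_wheelGraph (fun x y h => ?_) (fun i => ?_) (fun i => ?_)⟩
    · rw [norm_sub_rev, h, norm_sub_rev]
    · fin_cases i
      · change ‖r none - r (some 0)‖ = ‖q none - q (some 1)‖
        rw [hr]
        exact hq 0 1
      · exact hq 0 1
      · exact hq 0 2
      · exact hq 0 3
    · fin_cases i
      · simp [hr]
      · exact hq 1 2
      · exact hq 2 3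
      · change ‖r (some 3) - r (some 0)‖ = ‖q (some 3) - q (some 1)‖
        rw [hr]
        exact hq 3 1

theorem edgeCritical_wheelGraph : (wheelGraph 4).EdgeCritical 2 := by
  refine ⟨fun x => ?_, forall_adj_wheelGraph (fun x y h => h.symm) (fun i => ?_) (fun i => ?_)⟩
  · cases x with
    | none => exact ⟨some 0, trivial⟩
    | some i => exact ⟨none, trivial⟩
  · have h := edgeCriticalAt_wheelGraph_spoke
    fin_cases i
    · exact h
    · exact h.map wheelRotation
    · exact (h.map wheelRotation).map wheelRotation
    · exact ((h.map wheelRotation).map wheelRotation).map wheelRotation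
  · have h := edgeCriticalAt_wheelGraph_rim
    fin_cases i
    · exact h
    · exact h.map wheelRotation
    · exact (h.map wheelRotation).map wheelRotation
    · exact ((h.map wheelRotation).map wheelRotation).map wheelRotation

/-- Without the vertex `0`, the wheel is part of a `K₄`. -/
theorem ellInftyRealizable_three_wheelGraph : (wheelGraph 4).EllInftyRealizable 3 := by
  intro m r
  obtain ⟨q, hq⟩ := exists_realizes_range r ![none, some 1, some 2, some 3] (by decide)
  have key : ∀ x y, (wheelGraph 4).Adj x y →
      (x ≠ some 0 → y ≠ some 0 → ‖r x - r y‖ = ‖q x - q y‖) ∧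
      (x = some 0 → y = none ∨ y = some 1 ∨ y = some 3) ∧
      (y = some 0 → x = none ∨ x = some 1 ∨ x = some 3) := by
    refine forall_adj_wheelGraph (fun x y h => ⟨fun hx hy => ?_, h.2.2, h.2.1⟩)
      (fun i => ?_) (fun i => ?_)
    · rw [norm_sub_rev, h.1 hy hx, norm_sub_rev]
    · fin_cases i
      · exact ⟨fun _ h => absurd rfl h, by decide, by decide⟩
      · exact ⟨fun _ _ => hq 0 1, by decide, by decide⟩
      · exact ⟨fun _ _ => hq 0 2, by decide, by decide⟩
      · exact ⟨fun _ _ => hq 0 3, by decide, by decide⟩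
    · fin_cases i
      · exact ⟨fun h => absurd rfl h, by decide, by decide⟩
      · exact ⟨fun _ _ => hq 1 2, by decide, by decide⟩
      · exact ⟨fun _ _ => hq 2 3, by decide, by decide⟩
      · exact ⟨fun _ h => absurd rfl h, by decide, by decide⟩
  exact exists_realizes_three r q (some 0) none (some 1) (some 3) (fun x hx => (key _ x hx).2.1 rfl)
    (by decide) (by decide) (by decide) (hq 0 1) (hq 0 3) (hq 1 3)
    fun x y hx hy hxy => (key x y hxy).1 hx hy

instance : DecidableRel twoSumK4K4.Adj := fun _ _ => inferInstanceAs (Decidable (_ ∧ _))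

theorem forall_adj_twoSumK4K4 {P : Fin 6 → Fin 6 → Prop} (hs : ∀ x y, P x y → P y x)
    (h02 : P 0 2) (h03 : P 0 3) (h12 : P 1 2) (h13 : P 1 3) (h23 : P 2 3)
    (h04 : P 0 4) (h05 : P 0 5) (h14 : P 1 4) (h15 : P 1 5) (h45 : P 4 5) :
    ∀ x y, twoSumK4K4.Adj x y → P x y := by
  have hlt : ∀ x y : Fin 6, x < y → twoSumK4K4.Adj x y → P x y := by
    intro x y hxy h
    have : (x, y) ∈ ({(0, 2), (0, 3), (1, 2), (1, 3), (2, 3), (0, 4), (0, 5), (1, 4), (1, 5),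
        (4, 5)} : Finset (Fin 6 × Fin 6)) := by
      revert x y
      decide
    simp only [Finset.mem_insert, Finset.mem_singleton, Prod.mk.injEq] at this
    rcases this with ⟨rfl, rfl⟩ | ⟨rfl, rfl⟩ | ⟨rfl, rfl⟩ | ⟨rfl, rfl⟩ | ⟨rfl, rfl⟩ | ⟨rfl, rfl⟩ |
      ⟨rfl, rfl⟩ | ⟨rfl, rfl⟩ | ⟨rfl, rfl⟩ | ⟨rfl, rfl⟩ <;> assumption
  intro x y h
  rcases lt_or_gt_of_ne h.ne with hxy | hxy
  · exact hlt x y hxy h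
  · exact hs _ _ (hlt y x hxy h.symm)

theorem realizes_deleteEdges_twoSumK4K4 {m k : ℕ} {r : Fin 6 → Fin m → ℝ} {q : Fin 6 → Fin k → ℝ}
    (s : Set (Sym2 (Fin 6)))
    (h02 : s(0, 2) ∉ s → ‖r 0 - r 2‖ = ‖q 0 - q 2‖) (h03 : s(0, 3) ∉ s → ‖r 0 - r 3‖ = ‖q 0 - q 3‖)
    (h12 : s(1, 2) ∉ s → ‖r 1 - r 2‖ = ‖q 1 - q 2‖) (h13 : s(1, 3) ∉ s → ‖r 1 - r 3‖ = ‖q 1 - q 3‖)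
    (h23 : s(2, 3) ∉ s → ‖r 2 - r 3‖ = ‖q 2 - q 3‖) (h04 : s(0, 4) ∉ s → ‖r 0 - r 4‖ = ‖q 0 - q 4‖)
    (h05 : s(0, 5) ∉ s → ‖r 0 - r 5‖ = ‖q 0 - q 5‖) (h14 : s(1, 4) ∉ s → ‖r 1 - r 4‖ = ‖q 1 - q 4‖)
    (h15 : s(1, 5) ∉ s → ‖r 1 - r 5‖ = ‖q 1 - q 5‖)
    (h45 : s(4, 5) ∉ s → ‖r 4 - r 5‖ = ‖q 4 - q 5‖) :
    (twoSumK4K4.deleteEdges s).Realizes r q := by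
  intro x y hxy
  rw [deleteEdges_adj] at hxy
  revert hxy
  rw [and_imp]
  revert x y
  refine forall_adj_twoSumK4K4 (fun x y h hxy => ?_) h02 h03 h12 h13 h23 h04 h05 h14 h15 h45
  rw [norm_sub_rev, norm_sub_rev (q y)]
  exact h (by rwa [Sym2.eq_swap])

/-- One copy of `K₄`, including the deleted edge, and one further vertex attached to that edge. -/
theorem exists_realizes_add_vertex {m : ℕ} (r : Fin 6 → Fin m → ℝ) (v : Fin 6)
    (hv : v = 2 ∨ v = 3) :
    ∃ q : Fin 6 → Fin 2 → ℝ, (∀ i j, ‖r (![0, 1, 4, 5] i) - r (![0, 1, 4, 5] j)‖ =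
      ‖q (![0, 1, 4, 5] i) - q (![0, 1, 4, 5] j)‖) ∧
      ‖r 0 - r v‖ = ‖q 0 - q v‖ ∧ ‖r 1 - r v‖ = ‖q 1 - q v‖ := by
  obtain ⟨q, hq⟩ := exists_realizes_range r ![0, 1, 4, 5] (by decide)
  obtain ⟨q', h1, h2, h3⟩ := exists_update_vertex r q (v := v) (a := 0) (b := 1)
    (by revert v; decide) (by revert v; decide) (hq 0 1)
  rw [norm_sub_rev, norm_sub_rev (q' v)] at h2 h3
  have hne : ∀ i, (![0, 1, 4, 5] : Fin 4 → Fin 6) i ≠ v := by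
    clear h1 h2 h3
    revert v
    decide
  exact ⟨q', fun i j => by rw [h1 _ (hne i), h1 _ (hne j), hq], h2, h3⟩

/-- Without the edge `23`, both `2` and `3` are attached to `0` and `1`. -/
theorem edgeCriticalAt_twoSumK4K4_two_three : twoSumK4K4.EdgeCriticalAt 2 2 3 := by
  intro m r
  obtain ⟨q, k, h2, h3⟩ := exists_realizes_add_vertex r 2 (Or.inl rfl)
  constructor
  · obtain ⟨q', g1, g2, g3⟩ := exists_update_vertex r q (v := 3) (a := 0) (b := 1)
      (by decide) (by decide) (k 0 1)
    rw [norm_sub_rev, norm_sub_rev (q' 3)] at g2 g3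
    have hrest : ∀ x y, x ≠ 3 → y ≠ 3 → ‖r x - r y‖ = ‖q x - q y‖ →
        ‖r x - r y‖ = ‖q' x - q' y‖ := fun x y hx hy h => by rw [g1 x hx, g1 y hy, h]
    exact ⟨q', realizes_deleteEdges_twoSumK4K4 _ (fun _ => hrest _ _ (by decide) (by decide) h2)
      (fun _ => g2) (fun _ => hrest _ _ (by decide) (by decide) h3) (fun _ => g3)
      (fun h => absurd rfl h) (fun _ => hrest _ _ (by decide) (by decide) (k 0 2))
      (fun _ => hrest _ _ (by decide) (by decide) (k 0 3))
      (fun _ => hrest _ _ (by decide) (by decide) (k 1 2))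
      (fun _ => hrest _ _ (by decide) (by decide) (k 1 3))
      (fun _ => hrest _ _ (by decide) (by decide) (k 2 3))⟩
  · intro hr
    refine ⟨fun x => if x = 3 then q 2 else q x, forall_adj_twoSumK4K4
      (fun x y h => by rw [norm_sub_rev, h, norm_sub_rev]) h2 ?_ h3 ?_ ?_ (k 0 2) (k 0 3) (k 1 2)
      (k 1 3) (k 2 3)⟩
    · rw [← hr]
      exact h2
    · rw [← hr]
      exact h3
    · simp [hr]

/-- Without the edge `02`, the vertex `3` is attached to `0` and `1`, and then `2` to `1` and
`3`. -/
theorem edgeCriticalAt_twoSumK4K4_zero_two : twoSumK4K4.EdgeCriticalAt 2 0 2 := by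
  intro m r
  obtain ⟨q, k, h2, h3⟩ := exists_realizes_add_vertex r 3 (Or.inr rfl)
  constructor
  · obtain ⟨q', g1, g2, g3⟩ := exists_update_vertex r q (v := 2) (a := 1) (b := 3)
      (by decide) (by decide) h3
    rw [norm_sub_rev, norm_sub_rev (q' 2)] at g2
    have hrest : ∀ x y, x ≠ 2 → y ≠ 2 → ‖r x - r y‖ = ‖q x - q y‖ →
        ‖r x - r y‖ = ‖q' x - q' y‖ := fun x y hx hy h => by rw [g1 x hx, g1 y hy, h]
    exact ⟨q', realizes_deleteEdges_twoSumK4K4 _ (fun h => absurd rfl h)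
      (fun _ => hrest _ _ (by decide) (by decide) h2) (fun _ => g2)
      (fun _ => hrest _ _ (by decide) (by decide) h3)
      (fun _ => g3) (fun _ => hrest _ _ (by decide) (by decide) (k 0 2))
      (fun _ => hrest _ _ (by decide) (by decide) (k 0 3))
      (fun _ => hrest _ _ (by decide) (by decide) (k 1 2))
      (fun _ => hrest _ _ (by decide) (by decide) (k 1 3))
      (fun _ => hrest _ _ (by decide) (by decide) (k 2 3))⟩
  · intro hr
    refine ⟨fun x => if x = 2 then q 0 else q x, forall_adj_twoSumK4K4
      (fun x y h => by rw [norm_sub_rev, h, norm_sub_rev]) ?_ h2 ?_ h3 ?_ (k 0 2) (k 0 3) (k 1 2)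
      (k 1 3) (k 2 3)⟩
    · simp [hr]
    · rw [← hr]
      exact k 1 0
    · rw [← hr]
      exact h2

/-- The automorphism that exchanges the two ends of the deleted edge. -/
def twoSumSwapEnds : twoSumK4K4 ≃g twoSumK4K4 where
  toEquiv := Equiv.swap 0 1
  map_rel_iff' := by decide

/-- The automorphism that exchanges the other two vertices of the first copy of `K₄`. -/
def twoSumSwapInner : twoSumK4K4 ≃g twoSumK4K4 where
  toEquiv := Equiv.swap 2 3
  map_rel_iff' := by decide

/-- The automorphism that exchanges the two copies of `K₄`. -/
def twoSumSwapCopies : twoSumK4K4 ≃g twoSumK4K4 where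
  toEquiv := Equiv.swap 2 4 * Equiv.swap 3 5
  map_rel_iff' := by decide

theorem edgeCritical_twoSumK4K4 : twoSumK4K4.EdgeCritical 2 := by
  have h02 := edgeCriticalAt_twoSumK4K4_zero_two
  have h12 := h02.map twoSumSwapEnds
  have h03 := h02.map twoSumSwapInner
  have h13 := h12.map twoSumSwapInner
  have h23 := edgeCriticalAt_twoSumK4K4_two_three
  exact ⟨by decide, forall_adj_twoSumK4K4 (fun x y h => h.symm)
    h02 h03 h12 h13 h23 (h02.map twoSumSwapCopies) (h03.map twoSumSwapCopies)
    (h12.map twoSumSwapCopies) (h13.map twoSumSwapCopies) (h23.map twoSumSwapCopies)⟩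

/-- Without the vertex `3`, the graph is part of a `K₄` with a vertex attached to an edge. -/
theorem ellInftyRealizable_three_twoSumK4K4 : twoSumK4K4.EllInftyRealizable 3 := by
  intro m r
  obtain ⟨q, k, h2, h3⟩ := exists_realizes_add_vertex r 2 (Or.inl rfl)
  have key : ∀ x y, twoSumK4K4.Adj x y → (x ≠ 3 → y ≠ 3 → ‖r x - r y‖ = ‖q x - q y‖) := by
    exact forall_adj_twoSumK4K4 (fun x y h hx hy => by rw [norm_sub_rev, h hy hx, norm_sub_rev])
      (fun _ _ => h2) (fun _ h => absurd rfl h) (fun _ _ => h3) (fun _ h => absurd rfl h)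
      (fun _ h => absurd rfl h) (fun _ _ => k 0 2) (fun _ _ => k 0 3) (fun _ _ => k 1 2)
      (fun _ _ => k 1 3) (fun _ _ => k 2 3)
  exact exists_realizes_three r q 3 0 1 2 (by decide) (by decide) (by decide) (by decide)
    (k 0 1) h2 h3 fun x y hx hy hxy => key x y hxy hx hy

/-! ### Separations of small order -/

/-- `A` and `B` are the two sides of a separation of `G`, with separator `(A ∪ B)ᶜ`. -/
structure Splits (G : SimpleGraph V) (A B : Set V) : Prop where
  nonempty_left : A.Nonempty
  nonempty_right : B.Nonempty
  disjoint : Disjoint A B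
  not_adj : ∀ a ∈ A, ∀ b ∈ B, ¬ G.Adj a b

theorem Splits.symm {A B : Set V} (h : G.Splits A B) : G.Splits B A :=
  ⟨h.2, h.1, h.3.symm, fun b hb a ha hab => h.4 a ha b hb hab.symm⟩

/-- Every separation of `G` has order at least `k`. Unlike `k`-connectedness, this is no condition
on the number of vertices; complete graphs satisfy it for every `k`. -/
def SepOrderGE (G : SimpleGraph V) (k : ℕ) : Prop :=
  ∀ A B, G.Splits A B → k ≤ (A ∪ B)ᶜ.ncard

/-- A set `D` has a neighbour outside a set `X` that is too small to separate `D` from a further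
vertex. -/
theorem SepOrderGE.exists_adj [Finite V] {k : ℕ} (hG : G.SepOrderGE k) {D X : Set V}
    (hD : D.Nonempty) (hX : X.ncard < k) (hc : ∃ c, c ∉ D ∧ c ∉ X) :
    ∃ d ∈ D, ∃ v, v ∉ D ∧ v ∉ X ∧ G.Adj d v := by
  by_contra hno
  push Not at hno
  obtain ⟨c, hcD, hcX⟩ := hc
  have hs : G.Splits D (D ∪ X)ᶜ := by
    refine ⟨hD, ⟨c, fun h => h.elim hcD hcX⟩, ?_, fun a ha b hb => ?_⟩
    · exact Set.disjoint_left.2 fun x hx hx' => hx' (Or.inl hx)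
    · exact hno a ha b (fun h => hb (Or.inl h)) fun h => hb (Or.inr h)
  have hsub : (D ∪ (D ∪ X)ᶜ)ᶜ ⊆ X := by
    intro x hx
    by_contra hxX
    exact hx (by by_cases h : x ∈ D <;> simp [h, hxX])
  exact absurd ((hG _ _ hs).trans (Set.ncard_le_ncard hsub (Set.toFinite _))) (not_le.2 hX)

/-! ### Sides of a separation of order two -/

/-- Some edge of `G` joins `S` to `T`. -/
def Joined (G : SimpleGraph V) (S T : Set V) : Prop := ∃ a ∈ S, ∃ b ∈ T, G.Adj a b

theorem Joined.mono {S T S' T' : Set V} (h : G.Joined S T) (hS : S ⊆ S') (hT : T ⊆ T') :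
    G.Joined S' T' := by
  obtain ⟨a, ha, b, hb, hab⟩ := h
  exact ⟨a, hS ha, b, hT hb, hab⟩

theorem Joined.symm {S T : Set V} (h : G.Joined S T) : G.Joined T S := by
  obtain ⟨a, ha, b, hb, hab⟩ := h
  exact ⟨b, hb, a, ha, hab.symm⟩

/-- The sets `P`, `Q`, `S`, `T` are the branch sets of a model of `K₄` minus an edge in
`A ∪ {a, b}`, where the two nonadjacent vertices are represented by `P` and `Q` and are rooted
at `a` and `b`. -/
structure IsRootedModel (G : SimpleGraph V) (A : Set V) (a b : V) (P Q S T : Set V) : Prop where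
  subP : P ⊆ insert a A
  subQ : Q ⊆ insert b A
  subS : S ⊆ A
  subT : T ⊆ A
  memP : a ∈ P
  memQ : b ∈ Q
  connP : G.CutConnected P
  connQ : G.CutConnected Q
  connS : G.CutConnected S
  connT : G.CutConnected T
  disPQ : Disjoint P Q
  disPS : Disjoint P S
  disPT : Disjoint P T
  disQS : Disjoint Q S
  disQT : Disjoint Q T
  disST : Disjoint S T
  joinPS : G.Joined P S
  joinPT : G.Joined P T
  joinQS : G.Joined Q S
  joinQT : G.Joined Q T
  joinST : G.Joined S T

theorem IsRootedModel.swap {A P Q S T : Set V} {a b : V} (h : G.IsRootedModel A a b P Q S T) :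
    G.IsRootedModel A b a Q P S T where
  subP := h.subQ
  subQ := h.subP
  subS := h.subS
  subT := h.subT
  memP := h.memQ
  memQ := h.memP
  connP := h.connQ
  connQ := h.connP
  connS := h.connS
  connT := h.connT
  disPQ := h.disPQ.symm
  disPS := h.disQS
  disPT := h.disQT
  disQS := h.disPS
  disQT := h.disPT
  disST := h.disST
  joinPS := h.joinQS
  joinPT := h.joinQT
  joinQS := h.joinPS
  joinQT := h.joinPT
  joinST := h.joinST

theorem IsRootedModel.mono {A B P Q S T : Set V} {a b : V} (h : G.IsRootedModel A a b P Q S T)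
    (hAB : A ⊆ B) : G.IsRootedModel B a b P Q S T :=
  { h with
    subP := h.subP.trans (Set.insert_subset_insert hAB)
    subQ := h.subQ.trans (Set.insert_subset_insert hAB)
    subS := h.subS.trans hAB
    subT := h.subT.trans hAB }

/-- A rooted model in a part `D` of `A` with roots `a` and `w` becomes one in `A` with roots `a`
and `b`: the branch set at `w` absorbs `b` and everything outside `D`. -/
theorem IsRootedModel.extend {A D P Q S T : Set V} {a b w : V}
    (h : G.IsRootedModel D a w P Q S T) (hA : G.CutConnected A) (hDA : D ⊆ A) (hw : w ∈ A)
    (hwD : w ∉ D) (ha : a ∉ A) (hb : b ∉ A) (hab : a ≠ b)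
    (hD : ∀ x ∈ D, ∀ y, G.Adj x y → y ∈ D ∨ y = a ∨ y = w)
    (hbA : ∃ z ∈ A \ D, G.Adj b z) :
    G.IsRootedModel A a b P (Q ∪ insert b (A \ D)) S T := by
  have hconn : G.CutConnected (A \ D) := by
    refine cutConnected_of_forall_notMem w fun t ht h1 hwt _ => ?_
    obtain ⟨x, hx, y, hy, hxy⟩ := hA t (ht.trans Set.sdiff_subset) h1 ⟨w, hw, hwt⟩
    refine ⟨x, hx, y, ⟨⟨hy.1, fun hyD => ?_⟩, hy.2⟩, hxy⟩
    rcases hD y hyD x hxy.symm with hh | rfl | rfl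
    exacts [(ht hx).2 hh, ha (ht hx).1, hwt hx]
  have hdis : ∀ R : Set V, R ⊆ insert a D → Disjoint Q R → Disjoint (Q ∪ insert b (A \ D)) R := by
    intro R hR hQR
    refine Set.disjoint_union_left.2 ⟨hQR, Set.disjoint_left.2 fun x hx hxR => ?_⟩
    rcases hR hxR with rfl | hxD
    · rcases hx with rfl | hx
      exacts [hab rfl, ha hx.1]
    · rcases hx with rfl | hx
      exacts [hb (hDA hxD), hx.2 hxD]
  obtain ⟨z, hz, hbz⟩ := hbA
  exact
    { h with
      subP := h.subP.trans (Set.insert_subset_insert hDA)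
      subQ := Set.union_subset (h.subQ.trans ((Set.insert_subset hw hDA).trans
        (Set.subset_insert _ _))) (Set.insert_subset_insert Set.sdiff_subset)
      subS := h.subS.trans hDA
      subT := h.subT.trans hDA
      memQ := Or.inr (Or.inl rfl)
      connQ := h.connQ.union (hconn.insert_of_adj hz hbz) h.memQ (Or.inr ⟨hw, hwD⟩)
      disPQ := (hdis P h.subP h.disPQ.symm).symm
      disQS := hdis S (h.subS.trans (Set.subset_insert _ _)) h.disQS
      disQT := hdis T (h.subT.trans (Set.subset_insert _ _)) h.disQT
      joinQS := h.joinQS.mono Set.subset_union_left subset_rfl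
      joinQT := h.joinQT.mono Set.subset_union_left subset_rfl }

/-- Whenever the distance between `a` and `b` is reproduced in the plane, the vertices in `A` can
be placed such that the lengths of all edges at `A` are reproduced. -/
def Extends (G : SimpleGraph V) (A : Set V) (a b : V) : Prop :=
  ∀ (m : ℕ) (r : V → Fin m → ℝ) (q : V → Fin 2 → ℝ), ‖r a - r b‖ = ‖q a - q b‖ →
    ∃ q' : V → Fin 2 → ℝ, (∀ v ∉ A, q' v = q v) ∧
      ∀ x ∈ A, ∀ y, G.Adj x y → ‖r x - r y‖ = ‖q' x - q' y‖

theorem Extends.union {A B : Set V} {a b : V} (hA : G.Extends A a b) (hB : G.Extends B a b)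
    (haA : a ∉ A) (hbA : b ∉ A) (hn : ∀ x ∈ A, ∀ y ∈ B, ¬ G.Adj x y) :
    G.Extends (A ∪ B) a b := by
  intro m r q hq
  obtain ⟨q1, h1, h2⟩ := hA m r q hq
  obtain ⟨q2, h3, h4⟩ := hB m r q1 (by rw [h1 a haA, h1 b hbA, hq])
  refine ⟨q2, fun v hv => ?_, fun x hx y hxy => ?_⟩
  · rw [h3 v fun h => hv (Or.inr h), h1 v fun h => hv (Or.inl h)]
  · by_cases hxB : x ∈ B
    · exact h4 x hxB y hxy
    · have hxA := hx.resolve_right hxB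
      rw [h3 x hxB, h3 y fun h => hn x hxA y h hxy]
      exact h2 x hxA y hxy

/-- If `w` separates the neighbours of `a` from those of `b`, then `w` can be placed before the
two parts. -/
theorem Extends.series {A D E : Set V} {a b w : V} (hD : G.Extends D a w) (hE : G.Extends E b w)
    (hA : A = insert w (D ∪ E)) (hwD : w ∉ D) (hwE : w ∉ E) (ha : a ∉ A) (hb : b ∉ A)
    (hDE : Disjoint D E)
    (hDn : ∀ x ∈ D, ∀ y, G.Adj x y → y ∈ D ∨ y = a ∨ y = w)
    (hAn : ∀ x ∈ A, ∀ y, G.Adj x y → y ∈ A ∨ y = a ∨ y = b) : G.Extends A a b := by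
  intro m r q hq
  subst hA
  have haw : w ≠ a := fun h => ha (Or.inl h.symm)
  have hbw : w ≠ b := fun h => hb (Or.inl h.symm)
  have haD : a ∉ D := fun h => ha (Or.inr (Or.inl h))
  have haE : a ∉ E := fun h => ha (Or.inr (Or.inr h))
  have hbD : b ∉ D := fun h => hb (Or.inr (Or.inl h))
  have hbE : b ∉ E := fun h => hb (Or.inr (Or.inr h))
  obtain ⟨q0, h1, h2, h3⟩ := exists_update_vertex r q haw hbw hq
  obtain ⟨q1, h4, h5⟩ := hD m r q0 (by rw [norm_sub_rev, h2, norm_sub_rev])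
  obtain ⟨q2, h6, h7⟩ := hE m r q1 (by rw [norm_sub_rev, h3, norm_sub_rev, h4 b hbD, h4 w hwD])
  have hDq : ∀ x ∈ D, ∀ y, G.Adj x y → ‖r x - r y‖ = ‖q2 x - q2 y‖ := by
    intro x hx y hxy
    have hy : y ∉ E := by
      rcases hDn x hx y hxy with h | rfl | rfl
      exacts [fun hE => hDE.ne_of_mem h hE rfl, haE, hwE]
    rw [h6 x fun hE => hDE.ne_of_mem hx hE rfl, h6 y hy]
    exact h5 x hx y hxy
  refine ⟨q2, fun v hv => ?_, fun x hx y hxy => ?_⟩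
  · rw [h6 v fun h => hv (Or.inr (Or.inr h)), h4 v fun h => hv (Or.inr (Or.inl h)),
      h1 v fun h => hv (Or.inl h)]
  · rcases hx with rfl | hx | hx
    · rcases hAn x (Or.inl rfl) y hxy with (rfl | hy | hy) | rfl | rfl
      · exact absurd hxy (G.irrefl)
      · rw [norm_sub_rev, hDq y hy x hxy.symm, norm_sub_rev]
      · rw [norm_sub_rev, h7 y hy x hxy.symm, norm_sub_rev]
      · rw [h6 x hwE, h6 y haE, h4 x hwD, h4 y haD, h2]
      · rw [h6 x hwE, h6 y hbE, h4 x hwD, h4 y hbD, h3]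
    · exact hDq x hx y hxy
    · exact h7 x hx y hxy

/-- In a connected set `A`, either there are two disjoint connected sets, joined by an edge, that
both meet `X` and `Y`, or some vertex of `A` separates `X` from `Y` in `A`. -/
theorem CutConnected.exists_links_or_separator [Finite V] {A X Y : Set V} (hA : G.CutConnected A)
    (hXA : X ⊆ A) (hYA : Y ⊆ A) (hX : X.Nonempty) (hY : Y.Nonempty) :
    (∃ S T, S ⊆ A ∧ T ⊆ A ∧ G.CutConnected S ∧ G.CutConnected T ∧ Disjoint S T ∧ G.Joined S T ∧
      (S ∩ X).Nonempty ∧ (S ∩ Y).Nonempty ∧ (T ∩ X).Nonempty ∧ (T ∩ Y).Nonempty) ∨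
    ∃ w ∈ A, ∃ E ⊆ A, w ∉ E ∧ Disjoint E X ∧ (∀ y ∈ Y, y = w ∨ y ∈ E) ∧
      ∀ x ∈ E, ∀ z ∈ A, G.Adj x z → z ∈ E ∨ z = w := by
  let G' : SimpleGraph V :=
    { Adj := fun x y => G.Adj x y ∧ x ∈ A ∧ y ∈ A
      symm := ⟨fun x y h => ⟨h.1.symm, h.2.2, h.2.1⟩⟩
      loopless := ⟨fun x h => G.irrefl h.1⟩ }
  have hle : G' ≤ G := fun x y h => h.1
  have hA' : G'.CutConnected A := by
    intro t ht h1 h2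
    obtain ⟨a, ha, b, hb, hab⟩ := hA t ht h1 h2
    exact ⟨a, ha, b, hb, hab, ht ha, hb.1⟩
  have hsub : ∀ S, G'.CutConnected S → (S ∩ A).Nonempty → S ⊆ A := by
    intro S hS hne x hx
    by_contra hxA
    obtain ⟨a, -, b, hb, hab⟩ := hS (S ∩ A) Set.inter_subset_left hne ⟨x, hx, fun h => hxA h.2⟩
    exact hb.2 ⟨hb.1, hab.2.2⟩
  by_cases hall : ∀ w, G'.LinkedAvoiding X Y w
  · left
    obtain ⟨S, T, h1, h2, h3, h4, h5, h6, h7⟩ :=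
      exists_disjoint_links G' X Y hall (hX.mono Set.subset_union_left)
    have hSA := hsub S h1 (h4.mono (Set.inter_subset_inter_right _ hXA))
    have hTA := hsub T h2 (h6.mono (Set.inter_subset_inter_right _ hXA))
    obtain ⟨S', g1, g2, g3, g4, g5⟩ := hA.exists_adj_of_disjoint hSA hTA (h1.mono hle)
      (h4.mono Set.inter_subset_left) (h6.mono Set.inter_subset_left) h3
    exact ⟨S', T, g2, hTA, g3, h2.mono hle, g4, g5, h4.mono (Set.inter_subset_inter_left _ g1),
      h5.mono (Set.inter_subset_inter_left _ g1), h6, h7⟩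
  · right
    push Not at hall
    obtain ⟨w, hw⟩ := hall
    have hwA : w ∈ A := by
      by_contra hwA
      exact hw ⟨A, hA', by rwa [Set.inter_eq_right.2 hXA], by rwa [Set.inter_eq_right.2 hYA], hwA⟩
    refine ⟨w, hwA, G'.reach Y w, ?_, notMem_reach, ?_, fun y hy => ?_, fun x hx z hz hxz => ?_⟩
    · rintro v ⟨L, h1, h2, h3, -⟩
      exact hsub L h1 (h2.mono (Set.inter_subset_inter_right _ hYA)) h3
    · refine Set.disjoint_left.2 fun v hv hvX => hw (LinkedAvoiding.symm ?_)
      exact linkedAvoiding_iff.2 ⟨v, hv, hvX⟩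
    · by_cases h : y = w
      · exact Or.inl h
      · exact Or.inr (mem_reach_of_mem hy h)
    · by_cases h : z = w
      · exact Or.inr h
      · refine Or.inl (mem_reach_of_adj hx ⟨hxz, ?_, hz⟩ h)
        obtain ⟨L, h1, h2, h3, -⟩ := hx
        exact hsub L h1 (h2.mono (Set.inter_subset_inter_right _ hYA)) h3

/-- A vertex set `A` of a graph without separations of order at most one that is attached at `a` and
`b` only either contains a rooted model of `K₄` minus an edge or can always be placed in the plane
once `a` and `b` are placed. -/
theorem SepOrderGE.rootedModel_or_extends [Finite V] (hG : G.SepOrderGE 2) (n : ℕ) :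
    ∀ (A : Set V) (a b : V), A.ncard = n → a ≠ b → a ∉ A → b ∉ A →
      (∀ x ∈ A, ∀ y, G.Adj x y → y ∈ A ∨ y = a ∨ y = b) → (∃ c, c ∉ A ∧ c ≠ a ∧ c ≠ b) →
      (∃ P Q S T, G.IsRootedModel A a b P Q S T) ∨ G.Extends A a b := by
  induction n using Nat.strong_induction_on with
  | _ n ih =>
  rintro A a b rfl hab ha hb hA ⟨c, hcA, hca, hcb⟩
  rcases A.eq_empty_or_nonempty with rfl | hne
  · exact Or.inr fun m r q _ => ⟨q, fun _ _ => rfl, fun x hx => absurd hx (Set.notMem_empty x)⟩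
  by_cases hconn : G.CutConnected A
  · have hne' : ∀ a b, a ∉ A → b ∉ A → c ≠ b → (∀ x ∈ A, ∀ y, G.Adj x y → y ∈ A ∨ y = a ∨ y = b) →
        ({x | x ∈ A ∧ G.Adj a x}).Nonempty := by
      intro a b ha hb hcb hA
      obtain ⟨d, hd, v, hvA, hvb, hdv⟩ := hG.exists_adj (X := {b}) hne (by simp) ⟨c, hcA, hcb⟩
      rcases hA d hd v hdv with h | rfl | rfl
      exacts [absurd h hvA, ⟨d, hd, hdv.symm⟩, absurd rfl hvb]
    have hneX := hne' a b ha hb hcb hA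
    have hneY := hne' b a hb ha hca fun x hx y hxy => (hA x hx y hxy).imp_right Or.symm
    rcases hconn.exists_links_or_separator (X := {x | x ∈ A ∧ G.Adj a x})
      (Y := {x | x ∈ A ∧ G.Adj b x}) (fun x hx => hx.1) (fun x hx => hx.1) hneX hneY with
      ⟨S, T, hS, hT, cS, cT, dST, jST, ⟨p1, i1, i1'⟩, ⟨p2, i2, i2'⟩, ⟨p3, i3, i3'⟩, ⟨p4, i4, i4'⟩⟩ |
      ⟨w, hw, E, hEA, hwE, hEX, hEY, hE⟩
    · left
      refine ⟨{a}, {b}, S, T, ?_⟩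
      exact
        { subP := by simp
          subQ := by simp
          subS := hS
          subT := hT
          memP := rfl
          memQ := rfl
          connP := cutConnected_of_subsingleton Set.subsingleton_singleton
          connQ := cutConnected_of_subsingleton Set.subsingleton_singleton
          connS := cS
          connT := cT
          disPQ := by simpa using hab
          disPS := Set.disjoint_singleton_left.2 fun h => ha (hS h)
          disPT := Set.disjoint_singleton_left.2 fun h => ha (hT h)
          disQS := Set.disjoint_singleton_left.2 fun h => hb (hS h)
          disQT := Set.disjoint_singleton_left.2 fun h => hb (hT h)
          disST := dST
          joinPS := ⟨a, rfl, p1, i1, i1'.2⟩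
          joinPT := ⟨a, rfl, p3, i3, i3'.2⟩
          joinQS := ⟨b, rfl, p2, i2, i2'.2⟩
          joinQT := ⟨b, rfl, p4, i4, i4'.2⟩
          joinST := jST }
    · -- `E` is the part of `A - w` at `b`, and `D` is the rest
      set D : Set V := A \ insert w E with hDdef
      have hDA : D ⊆ A := Set.sdiff_subset
      have hwD : w ∉ D := fun h => h.2 (Or.inl rfl)
      have hDE : Disjoint D E := Set.disjoint_left.2 fun x hx hxE => hx.2 (Or.inr hxE)
      have hAeq : A = insert w (D ∪ E) := by
        ext x
        constructor
        · intro hx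
          by_cases h1 : x = w
          · exact Or.inl h1
          by_cases h2 : x ∈ E
          · exact Or.inr (Or.inr h2)
          · exact Or.inr (Or.inl ⟨hx, fun h => h.elim h1 h2⟩)
        · rintro (rfl | h | h)
          exacts [hw, hDA h, hEA h]
      have hDn : ∀ x ∈ D, ∀ y, G.Adj x y → y ∈ D ∨ y = a ∨ y = w := by
        intro x hx y hxy
        rcases hA x hx.1 y hxy with hy | rfl | rfl
        · by_cases h1 : y = w
          · exact Or.inr (Or.inr h1)
          refine Or.inl ⟨hy, fun h => ?_⟩
          rcases hE y (h.resolve_left h1) x hx.1 hxy.symm with h' | h'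
          exacts [hx.2 (Or.inr h'), hx.2 (Or.inl h')]
        · exact Or.inr (Or.inl rfl)
        · exact absurd (hEY x ⟨hx.1, hxy.symm⟩) hx.2
      have hEn : ∀ x ∈ E, ∀ y, G.Adj x y → y ∈ E ∨ y = b ∨ y = w := by
        intro x hx y hxy
        rcases hA x (hEA hx) y hxy with hy | rfl | rfl
        · exact (hE x hx y hy hxy).imp_right Or.inr
        · exact absurd ⟨hEA hx, hxy.symm⟩ (Set.disjoint_left.1 hEX hx)
        · exact Or.inr (Or.inl rfl)
      have hlt : ∀ B, B ⊆ A → w ∉ B → B.ncard < A.ncard := fun B hB hwB =>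
        Set.ncard_lt_ncard ⟨hB, fun h => hwB (h hw)⟩ (Set.toFinite _)
      have haw : a ≠ w := fun h => ha (h ▸ hw)
      have hbw : b ≠ w := fun h => hb (h ▸ hw)
      rcases ih _ (hlt D hDA hwD) D a w rfl haw (fun h => ha (hDA h)) hwD hDn
        ⟨b, fun h => hb (hDA h), hab.symm, hbw⟩ with ⟨P, Q, S, T, h⟩ | h1
      · left
        refine ⟨P, _, S, T, h.extend hconn hDA hw hwD ha hb hab hDn ?_⟩
        obtain ⟨z, hz, hbz⟩ := hneY
        exact ⟨z, ⟨hz, fun hzD => hzD.2 (hEY z ⟨hz, hbz⟩)⟩, hbz⟩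
      rcases ih _ (hlt E hEA hwE) E b w rfl hbw (fun h => hb (hEA h)) hwE hEn
        ⟨a, fun h => ha (hEA h), hab, haw⟩ with ⟨P, Q, S, T, h⟩ | h2
      · left
        refine ⟨_, P, S, T, (h.extend hconn hEA hw hwE hb ha hab.symm hEn ?_).swap⟩
        obtain ⟨z, hz, haz⟩ := hneX
        exact ⟨z, ⟨hz, fun hzE => Set.disjoint_left.1 hEX hzE ⟨hz, haz⟩⟩, haz⟩
      · exact Or.inr (h1.series h2 hAeq hwD hwE ha hb hDE hDn hA)
  · -- otherwise the two parts of a division of `A` are treated separately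
    unfold CutConnected at hconn
    push Not at hconn
    obtain ⟨B, hBA, hB, hC, hn⟩ := hconn
    have hlt1 : B.ncard < A.ncard := Set.ncard_lt_ncard
      ⟨hBA, fun h => hC.ne_empty (Set.sdiff_eq_empty.2 h)⟩ (Set.toFinite _)
    have hlt2 : (A \ B).ncard < A.ncard := Set.ncard_lt_ncard
      ⟨Set.sdiff_subset, fun h => by
        obtain ⟨x, hx⟩ := hB
        exact (h (hBA hx)).2 hx⟩ (Set.toFinite _)
    rcases ih _ hlt1 B a b rfl hab (fun h => ha (hBA h)) (fun h => hb (hBA h))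
      (fun x hx y hxy => by
        rcases hA x (hBA hx) y hxy with h | h
        · refine Or.inl (by_contra fun h' => hn x hx y ⟨h, h'⟩ hxy)
        · exact Or.inr h) ⟨c, fun h => hcA (hBA h), hca, hcb⟩ with ⟨P, Q, S, T, h⟩ | h1
    · exact Or.inl ⟨P, Q, S, T, h.mono hBA⟩
    rcases ih _ hlt2 (A \ B) a b rfl hab (fun h => ha h.1) (fun h => hb h.1)
      (fun x hx y hxy => by
        rcases hA x hx.1 y hxy with h | h
        · exact Or.inl ⟨h, fun h' => hn y h' x hx hxy.symm⟩
        · exact Or.inr h) ⟨c, fun h => hcA h.1, hca, hcb⟩ with ⟨P, Q, S, T, h⟩ | h2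
    · exact Or.inl ⟨P, Q, S, T, h.mono Set.sdiff_subset⟩
    · right
      have h3 := h1.union h2 (fun h => ha (hBA h)) (fun h => hb (hBA h)) hn
      rwa [Set.union_sdiff_cancel hBA] at h3

/-! ### Wheel minors of graphs without separations of order two -/

theorem ncard_pair_le (a b : V) : ({a, b} : Set V).ncard ≤ 2 :=
  (Set.ncard_insert_le _ _).trans (by rw [Set.ncard_singleton])

theorem ncard_triple_le (a b c : V) : ({a, b, c} : Set V).ncard ≤ 3 :=
  (Set.ncard_insert_le _ _).trans (Nat.succ_le_succ (ncard_pair_le b c))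

theorem ncard_quadruple_le (a b c d : V) : ({a, b, c, d} : Set V).ncard ≤ 4 :=
  (Set.ncard_insert_le _ _).trans (Nat.succ_le_succ (ncard_triple_le b c d))

theorem SepOrderGE.compl_eq [Finite V] (hG : G.SepOrderGE 3) {A B : Set V} {x y z : V}
    (h : G.Splits A B) (hc : (A ∪ B)ᶜ ⊆ {x, y, z}) : (A ∪ B)ᶜ = {x, y, z} :=
  Set.eq_of_subset_of_ncard_le hc ((ncard_triple_le x y z).trans (hG A B h)) (Set.toFinite _)

theorem SepOrderGE.ne_of_compl [Finite V] (hG : G.SepOrderGE 3) {A B : Set V} {x y z : V}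
    (h : G.Splits A B) (hc : (A ∪ B)ᶜ = {x, y, z}) : x ≠ z ∧ y ≠ z := by
  have h3 := hG A B h
  rw [hc] at h3
  constructor
  · rintro rfl
    rw [Set.insert_comm, Set.pair_eq_singleton] at h3
    exact absurd (h3.trans (ncard_pair_le y x)) (by norm_num)
  · rintro rfl
    rw [Set.pair_eq_singleton] at h3
    exact absurd (h3.trans (ncard_pair_le x y)) (by norm_num)

/-- Each vertex of a minimal separator has a neighbour on each side. -/
theorem SepOrderGE.exists_adj_of_compl [Finite V] (hG : G.SepOrderGE 3) {A B : Set V} {x y z : V}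
    (h : G.Splits A B) (hc : (A ∪ B)ᶜ = {x, y, z}) : ∃ v ∈ A, G.Adj v z := by
  have hmem : ∀ p, p ∈ ({x, y, z} : Set V) ↔ p ∉ A ∪ B := fun p => by
    rw [← hc]
    rfl
  obtain ⟨c, hcB⟩ := h.nonempty_right
  obtain ⟨v, hv, u, huA, hu, hvu⟩ := hG.exists_adj (X := {x, y}) h.nonempty_left
    ((ncard_pair_le x y).trans_lt (by norm_num))
    ⟨c, fun hcA => h.disjoint.ne_of_mem hcA hcB rfl, fun hc' => by
      refine (hmem c).1 ?_ (Or.inr hcB)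
      rcases hc' with rfl | hc'
      · exact Or.inl rfl
      · exact Or.inr (Or.inl hc')⟩
  have huz : u ∈ ({x, y, z} : Set V) :=
    (hmem u).2 fun h' => h'.elim huA fun huB => h.not_adj v hv u huB hvu
  rcases huz with rfl | rfl | huz
  · exact absurd (Or.inl rfl) hu
  · exact absurd (Or.inr rfl) hu
  · rw [Set.mem_singleton_iff] at huz
    exact ⟨v, hv, huz ▸ hvu⟩

/-- Thomassen's lemma: if all separations have order at least three, then some edge `xy` lies in no
separator of order three. Otherwise, consider such a separator `{x, y, z}` with an inclusion-minimal
side `A` and a neighbour `v ∈ A` of `z`. A separator `{z, v, w}` has a side that avoids `x` and `y`,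
and the intersection of that side with `A` contradicts minimality. -/
theorem SepOrderGE.exists_contractible_edge [Finite V] (hG : G.SepOrderGE 3)
    (hE : ∃ x y, G.Adj x y) :
    ∃ x y, G.Adj x y ∧ ∀ z A B, G.Splits A B → ¬ (A ∪ B)ᶜ ⊆ {x, y, z} := by
  by_contra hno
  push Not at hno
  have hfin : {A : Set V | ∃ x y z B, G.Adj x y ∧ G.Splits A B ∧ (A ∪ B)ᶜ ⊆ {x, y, z}}.Finite :=
    Set.toFinite _
  obtain ⟨M, ⟨x, y, z, N, hxy, hMN, hc⟩, hmin⟩ := hfin.exists_minimal (by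
    obtain ⟨x, y, hxy⟩ := hE
    obtain ⟨z, A, B, hAB, hc⟩ := hno x y hxy
    exact ⟨A, x, y, z, B, hxy, hAB, hc⟩)
  have hc' := hG.compl_eq hMN hc
  have hmem : ∀ p, p ∈ ({x, y, z} : Set V) ↔ p ∉ M ∪ N := fun p => by
    rw [← hc']
    rfl
  obtain ⟨hxz, hyz⟩ := hG.ne_of_compl hMN hc'
  obtain ⟨v, hvM, hvz⟩ := hG.exists_adj_of_compl hMN hc'
  obtain ⟨w, A, B, hAB, hcA⟩ := hno z v hvz.symm
  have hxM : x ∉ M := fun h => (hmem x).1 (by simp) (Or.inl h)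
  have hyM : y ∉ M := fun h => (hmem y).1 (by simp) (Or.inl h)
  have hxv : x ≠ v := fun h => hxM (h ▸ hvM)
  have hyv : y ≠ v := fun h => hyM (h ▸ hvM)
  have key : ∀ A B, G.Splits A B → (A ∪ B)ᶜ ⊆ {z, v, w} → x ∉ A → y ∉ A → False := by
    intro A B hAB hcA hxA hyA
    have hcA' := hG.compl_eq hAB hcA
    have hmemA : ∀ p, p ∈ ({z, v, w} : Set V) ↔ p ∉ A ∪ B := fun p => by
      rw [← hcA']
      rfl
    have hzA : z ∉ A := fun h => (hmemA z).1 (by simp) (Or.inl h)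
    have hvA : v ∉ A := fun h => (hmemA v).1 (by simp) (Or.inl h)
    obtain ⟨d, hdA, hdv⟩ := hG.exists_adj_of_compl (x := z) (y := w) (z := v) hAB
      (by rw [hcA', Set.pair_comm])
    have hdM : d ∈ M := by
      by_contra hdM
      have : d ∈ ({x, y, z} : Set V) :=
        (hmem d).2 fun h => h.elim hdM fun hN => hMN.not_adj v hvM d hN hdv.symm
      rcases this with rfl | rfl | rfl
      exacts [hxA hdA, hyA hdA, hzA hdA]
    have hM : M ⊆ M ∩ A :=
      hmin ⟨z, v, w, (M ∩ A ∪ {z, v, w})ᶜ, hvz.symm, ?_, ?_⟩ Set.inter_subset_left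
    · exact hvA (hM hvM).2
    · refine ⟨⟨d, hdM, hdA⟩, ?_, ?_, ?_⟩
      · by_cases hxw : x = w
        · refine ⟨y, ?_⟩
          rintro (h | rfl | rfl | rfl)
          exacts [hyM h.1, hyz rfl, hyv rfl, hxy.ne hxw]
        · refine ⟨x, ?_⟩
          rintro (h | rfl | rfl | rfl)
          exacts [hxM h.1, hxz rfl, hxv rfl, hxw rfl]
      · exact Set.disjoint_left.2 fun p hp hp' => hp' (Or.inl hp)
      · intro p hp p' hp' hpp
        have hpz : p' ∉ ({z, v, w} : Set V) := fun h => hp' (Or.inr h)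
        have hpA : p' ∈ A := by
          by_contra h
          exact hpz ((hmemA p').2 fun h' => h'.elim h fun hB => hAB.not_adj p hp.2 p' hB hpp)
        have hpM : p' ∈ M := by
          by_contra h
          have : p' ∈ ({x, y, z} : Set V) :=
            (hmem p').2 fun h' => h'.elim h fun hN => hMN.not_adj p hp.1 p' hN hpp
          rcases this with rfl | rfl | rfl
          exacts [hxA hpA, hyA hpA, hzA hpA]
        exact hp' (Or.inl ⟨hpM, hpA⟩)
    · intro p hp
      by_contra h
      exact hp (Or.inr fun h' => h'.elim (fun h'' => hp (Or.inl h'')) h)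
  by_cases h : x ∈ A ∨ y ∈ A
  · refine key B A hAB.symm (by rwa [Set.union_comm]) (fun hx => ?_) fun hy => ?_
    · rcases h with h | h
      · exact hAB.disjoint.ne_of_mem h hx rfl
      · exact hAB.not_adj y h x hx hxy.symm
    · rcases h with h | h
      · exact hAB.not_adj x h y hy hxy
      · exact hAB.disjoint.ne_of_mem h hy rfl
  · push Not at h
    exact key A B hAB hcA h.1 h.2

/-- The map that contracts `y` to `x`. -/
noncomputable def contractTo {x y : V} (h : x ≠ y) (v : V) : {v // v ≠ y} :=
  open Classical in if hv : v = y then ⟨x, h⟩ else ⟨v, hv⟩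

theorem contractTo_self {x y : V} (h : x ≠ y) : contractTo h y = ⟨x, h⟩ := by
  simp [contractTo]

theorem contractTo_of_ne {x y v : V} (h : x ≠ y) (hv : v ≠ y) : contractTo h v = ⟨v, hv⟩ := by
  simp [contractTo, hv]

theorem contractTo_surjective {x y : V} (h : x ≠ y) : Function.Surjective (contractTo h) :=
  fun w => ⟨w, contractTo_of_ne h w.2⟩

theorem cutConnected_preimage_contractTo {x y : V} (hxy : G.Adj x y) (w : {v // v ≠ y}) :
    G.CutConnected (contractTo hxy.ne ⁻¹' {w}) := by
  by_cases hw : w = ⟨x, hxy.ne⟩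
  · have : contractTo hxy.ne ⁻¹' {w} = {x, y} := by
      ext v
      by_cases hv : v = y
      · subst hv
        simp [contractTo_self, hw]
      · simp [contractTo_of_ne hxy.ne hv, hw, hv]
    rw [this]
    exact cutConnected_pair hxy
  · refine cutConnected_of_subsingleton fun a ha b hb => ?_
    have hne : ∀ a, contractTo hxy.ne a = w → a = w := by
      intro a ha
      by_cases hay : a = y
      · subst hay
        exact absurd (ha.symm.trans (contractTo_self _)) hw
      · rw [contractTo_of_ne hxy.ne hay] at ha
        exact congrArg Subtype.val ha
    exact (hne a ha).trans (hne b hb).symm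

theorem SepOrderGE.map_contractTo [Finite V] (hG : G.SepOrderGE 3) {x y : V} (hxy : G.Adj x y)
    (h : ∀ z A B, G.Splits A B → ¬ (A ∪ B)ᶜ ⊆ {x, y, z}) :
    (G.map (contractTo hxy.ne)).SepOrderGE 3 := by
  intro A B hAB
  set f := contractTo hxy.ne with hf
  have hs : G.Splits (f ⁻¹' A) (f ⁻¹' B) := by
    refine ⟨?_, ?_, hAB.disjoint.preimage f, fun a ha b hb hab => ?_⟩
    · obtain ⟨w, hw⟩ := hAB.nonempty_left
      obtain ⟨v, rfl⟩ := contractTo_surjective hxy.ne w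
      exact ⟨v, hw⟩
    · obtain ⟨w, hw⟩ := hAB.nonempty_right
      obtain ⟨v, rfl⟩ := contractTo_surjective hxy.ne w
      exact ⟨v, hw⟩
    · exact hAB.not_adj _ ha _ hb ⟨hAB.disjoint.ne_of_mem ha hb, a, b, hab, rfl, rfl⟩
  have hcompl : (f ⁻¹' A ∪ f ⁻¹' B)ᶜ = f ⁻¹' (A ∪ B)ᶜ := rfl
  by_contra hlt
  have h2 : ¬ 2 < (A ∪ B)ᶜ.ncard := fun h' => hlt h'
  rw [Set.two_lt_ncard_iff (Set.toFinite _)] at h2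
  push Not at h2
  have hval : ∀ v, v ≠ y → (f v : V) = v := fun v hv => by rw [hf, contractTo_of_ne hxy.ne hv]
  have hy : f y = ⟨x, hxy.ne⟩ := contractTo_self hxy.ne
  by_cases hx : (⟨x, hxy.ne⟩ : {v // v ≠ y}) ∈ (A ∪ B)ᶜ
  · -- the separator contains the contracted vertex and at most one other vertex `z`
    obtain ⟨z, hz⟩ : ∃ z : V, ∀ w ∈ (A ∪ B)ᶜ, (w : V) = x ∨ (w : V) = z := by
      by_cases hz : ∃ z ∈ (A ∪ B)ᶜ, z ≠ ⟨x, hxy.ne⟩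
      · obtain ⟨z, hz, hzx⟩ := hz
        refine ⟨z, fun w hw => ?_⟩
        by_cases hwx : w = ⟨x, hxy.ne⟩
        · exact Or.inl (congrArg Subtype.val hwx)
        · exact Or.inr (congrArg Subtype.val
            (h2 _ z w hx hz hw hzx.symm (Ne.symm hwx)).symm)
      · push Not at hz
        exact ⟨x, fun w hw => Or.inl (congrArg Subtype.val (hz w hw))⟩
    refine h z _ _ hs fun v hv => ?_
    by_cases hvy : v = y
    · exact Or.inr (Or.inl hvy)
    · have := hz (f v) hv
      rw [hval v hvy] at this
      rcases this with h' | h'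
      exacts [Or.inl h', Or.inr (Or.inr h')]
  · have h3 := hG _ _ hs
    have hsub : (f ⁻¹' A ∪ f ⁻¹' B)ᶜ ⊆ Subtype.val '' (A ∪ B)ᶜ := by
      intro v hv
      by_cases hvy : v = y
      · subst hvy
        exact absurd (hy ▸ hv : (⟨x, hxy.ne⟩ : {w // w ≠ v}) ∈ (A ∪ B)ᶜ) hx
      · exact ⟨f v, hv, hval v hvy⟩
    exact hlt (h3.trans ((Set.ncard_le_ncard hsub (Set.toFinite _)).trans
      (Set.ncard_image_le (Set.toFinite _))))

/-- A graph on five vertices without separations of order two misses at most two disjoint edges of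
the complete graph. -/
theorem SepOrderGE.hasModel_wheelGraph_of_card_eq [Finite V] (hG : G.SepOrderGE 3)
    (hV : Nat.card V = 5) : (wheelGraph 4).HasModel G := by
  have hex : ∀ X : Set V, X.ncard ≤ 4 → ∃ p, p ∉ X := by
    intro X hX
    by_contra h
    push Not at h
    rw [Set.eq_univ_of_forall h, Set.ncard_univ, hV] at hX
    omega
  have hdeg : ∀ v a b, a ≠ v → b ≠ v → a ≠ b → ¬ G.Adj v a → G.Adj v b := by
    intro v a b hav hbv hab hva
    by_contra hvb
    have hcard : ({v, a, b} : Set V)ᶜ.ncard < 3 := by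
      have h1 := Set.ncard_add_ncard_compl ({v, a, b} : Set V)
      have h2 : ({v, a, b} : Set V).ncard = 3 := Set.ncard_eq_three.2
        ⟨v, a, b, hav.symm, hbv.symm, hab, rfl⟩
      omega
    obtain ⟨d, hd, u, hu, hu', hdu⟩ := hG.exists_adj (D := {v}) (Set.singleton_nonempty v) hcard
      ⟨a, hav, by simp⟩
    rw [Set.mem_singleton_iff] at hd
    subst hd
    rw [Set.notMem_compl_iff] at hu'
    rcases hu' with rfl | rfl | rfl
    exacts [hu rfl, hva hdu, hvb hdu]
  have choice : ∀ S : Set V, (∃ p ∈ S, ∃ q ∈ S, p ≠ q) → ∃ p ∈ S, ∃ q ∈ S, p ≠ q ∧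
      ∀ s ∈ S, s ≠ p → s ≠ q → G.Adj p s ∧ G.Adj q s := by
    rintro S ⟨p, hp, q, hq, hpq⟩
    by_cases h : ∃ p ∈ S, ∃ q ∈ S, p ≠ q ∧ ¬ G.Adj p q
    · obtain ⟨p, hp, q, hq, hpq, hn⟩ := h
      exact ⟨p, hp, q, hq, hpq, fun s _ hsp hsq => ⟨hdeg p q s hpq.symm hsp hsq.symm hn,
        hdeg q p s hpq hsq hsp.symm fun h => hn h.symm⟩⟩
    · push Not at h
      exact ⟨p, hp, q, hq, hpq, fun s hs hsp hsq => ⟨h p hp s hs hsp.symm, h q hq s hs hsq.symm⟩⟩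
  obtain ⟨p, -⟩ := hex ∅ (by simp)
  obtain ⟨q, hq⟩ := hex {p} (by simp)
  obtain ⟨a, -, b, -, hab, h1⟩ := choice Set.univ ⟨q, trivial, p, trivial, hq⟩
  obtain ⟨p', hp'⟩ := hex {a, b} ((ncard_pair_le a b).trans (by norm_num))
  obtain ⟨q', hq'⟩ := hex {p', a, b} ((ncard_triple_le p' a b).trans (by norm_num))
  obtain ⟨c, hc, d, hd, hcd, h2⟩ := choice {a, b}ᶜ ⟨p', hp', q', fun h => hq' (Or.inr h),
    fun h => hq' (Or.inl h.symm)⟩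
  obtain ⟨e, he⟩ := hex {a, b, c, d} (ncard_quadruple_le a b c d)
  simp only [Set.mem_insert_iff, Set.mem_singleton_iff, Set.mem_compl_iff, not_or] at hc hd he
  obtain ⟨hea, heb, hec, hed⟩ := he
  have hce := (h2 e (by simp [hea, heb]) hec hed)
  have hae := h1 e trivial hea heb
  have hac := h1 c trivial hc.1 hc.2
  have had := h1 d trivial hd.1 hd.2
  let f : Option (Fin 4) → V
    | none => e
    | some 0 => a
    | some 1 => c
    | some 2 => b
    | some 3 => d
  refine HasModel.of_injective f ?_ (forall_adj_wheelGraph (fun x y h => h.symm) (fun i => ?_)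
    (fun i => ?_))
  · have hne : ∀ i : Fin 4, f none ≠ f (some i) := by
      intro i
      fin_cases i
      exacts [hea, hec, heb, hed]
    have hne' : ∀ i j : Fin 4, i < j → f (some i) ≠ f (some j) := by
      intro i j hij
      fin_cases i <;> fin_cases j <;>
        first
          | exact absurd hij (by decide)
          | exact Ne.symm hc.1
          | exact hab
          | exact Ne.symm hd.1
          | exact hc.2
          | exact hcd
          | exact Ne.symm hd.2
    rintro (_ | i) (_ | j) hij
    · rfl
    · exact absurd hij (hne j)
    · exact absurd hij.symm (hne i)
    · rcases lt_trichotomy i j with h | rfl | h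
      · exact absurd hij (hne' i j h)
      · rfl
      · exact absurd hij.symm (hne' j i h)
  · fin_cases i
    exacts [hae.1.symm, hce.1.symm, hae.2.symm, hce.2.symm]
  · fin_cases i
    exacts [hac.1, hac.2.symm, had.2, had.1.symm]

/-- The argument contracts edges while separations of order two are avoided, down to five
vertices. -/
theorem SepOrderGE.hasModel_wheelGraph (n : ℕ) : ∀ (V : Type u) [Finite V] (G : SimpleGraph V),
    G.SepOrderGE 3 → Nat.card V = n + 5 → (wheelGraph 4).HasModel G := by
  induction n with
  | zero => exact fun V _ G hG hV => hG.hasModel_wheelGraph_of_card_eq hV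
  | succ n ih =>
    intro V _ G hG hV
    have hcard : ∀ X : Set V, X.ncard < n + 6 → ∃ p, p ∉ X := by
      intro X hX
      by_contra h
      push Not at h
      rw [Set.eq_univ_of_forall h, Set.ncard_univ, hV] at hX
      omega
    obtain ⟨p, -⟩ := hcard ∅ (by simp)
    obtain ⟨q, hq⟩ := hcard {p} (by simp)
    obtain ⟨d, -, v, -, -, hdv⟩ := hG.exists_adj (D := {p}) (X := ∅) ⟨p, rfl⟩ (by simp)
      ⟨q, hq, by simp⟩
    obtain ⟨x, y, hxy, h⟩ := hG.exists_contractible_edge ⟨d, v, hdv⟩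
    have hmodel := ih {v // v ≠ y} (G.map (contractTo hxy.ne)) (hG.map_contractTo hxy h) (by
      have h1 := Set.ncard_add_ncard_compl ({y} : Set V)
      rw [Set.ncard_singleton, hV] at h1
      have h2 : Nat.card {v // v ≠ y} = ({y} : Set V)ᶜ.ncard := rfl
      omega)
    exact hmodel.of_map (contractTo_surjective hxy.ne) (cutConnected_preimage_contractTo hxy)

/-! ### Excluded minors -/

theorem IsExcludedMinorFInftyLE.not_realizable {k : ℕ} (h : G.IsExcludedMinorFInftyLE k) :
    ¬ G.EllInftyRealizable k := fun hh => h.1 (fInfty_le_iff.2 hh)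

theorem IsExcludedMinorFInftyLE.realizable_of_card_lt {k : ℕ}
    (h : G.IsExcludedMinorFInftyLE k) {U : Type u} [Finite U] {H : SimpleGraph U}
    (hH : H.HasModel G) (hc : Nat.card U < Nat.card V) : H.EllInftyRealizable k :=
  fInfty_le_iff.1 (h.2 U H hH.isMinorOf ⟨fun e => hc.ne (Nat.card_congr e.toEquiv)⟩)

/-- A graph that is not realizable can be a minor of an excluded minor in the trivial way only. -/
theorem IsExcludedMinorFInftyLE.nonempty_iso {k : ℕ} (h : G.IsExcludedMinorFInftyLE k)
    {U : Type} [Finite U] {H : SimpleGraph U} (hH : H.HasModel G)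
    (hn : ¬ H.EllInftyRealizable k) : Nonempty (G ≃g H) := by
  by_contra hno
  let e : H.comap (Equiv.ulift : ULift.{u} U ≃ U) ≃g H := Iso.comap Equiv.ulift H
  have h1 := h.2 (ULift.{u} U) (H.comap (Equiv.ulift : ULift.{u} U ≃ U))
    (hH.of_iso_left e).isMinorOf ⟨fun e' => hno ⟨e'.symm.trans e⟩⟩
  exact hn ((fInfty_le_iff.1 h1).of_iso e.symm)

theorem Splits.card_lt [Finite V] {A B : Set V} (h : G.Splits A B) :
    Nat.card (Aᶜ : Set V) < Nat.card V := by
  have h1 := Set.ncard_add_ncard_compl A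
  have h2 := (Set.ncard_pos (Set.toFinite A)).2 h.nonempty_left
  rw [Nat.card_coe_set_eq]
  omega

/-- Plane realizations of two induced subgraphs that share at most one vertex can be glued by a
translation. -/
theorem IsExcludedMinorFInftyLE.sepOrderGE_two [Finite V] (h : G.IsExcludedMinorFInftyLE 2) :
    G.SepOrderGE 2 := by
  classical
  intro A B hAB
  by_contra hlt
  have hsub : ∀ p ∈ (A ∪ B)ᶜ, ∀ p' ∈ (A ∪ B)ᶜ, p = p' := fun p hp p' hp' =>
    (Set.ncard_le_one (Set.toFinite _)).1 (by omega) p hp p' hp'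
  have part : ∀ A B : Set V, G.Splits A B → ∀ (m : ℕ) (r : V → Fin m → ℝ),
      ∃ q : V → Fin 2 → ℝ, ∀ x ∉ A, ∀ y ∉ A, G.Adj x y → ‖r x - r y‖ = ‖q x - q y‖ := by
    intro A B hAB m r
    obtain ⟨q, hq⟩ := h.realizable_of_card_lt (H := G.induce Aᶜ)
      (HasModel.of_injective Subtype.val Subtype.val_injective fun _ _ h => h) hAB.card_lt m
      fun v => r v
    refine ⟨fun v => if hv : v ∉ A then q ⟨v, hv⟩ else 0, fun x hx y hy hxy => ?_⟩
    beta_reduce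
    rw [dif_pos hx, dif_pos hy]
    exact hq ⟨x, hx⟩ ⟨y, hy⟩ hxy
  refine h.not_realizable fun m r => ?_
  obtain ⟨q1, h1⟩ := part A B hAB m r
  obtain ⟨q2, h2⟩ := part B A hAB.symm m r
  obtain ⟨t, ht⟩ : ∃ t, ∀ p ∈ (A ∪ B)ᶜ, q1 p + t = q2 p := by
    by_cases hp : ∃ p, p ∈ (A ∪ B)ᶜ
    · obtain ⟨p, hp⟩ := hp
      exact ⟨q2 p - q1 p, fun p' hp' => by rw [hsub p' hp' p hp]; abel⟩
    · push Not at hp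
      exact ⟨0, fun p hp' => absurd hp' (hp p)⟩
  let q : V → Fin 2 → ℝ := fun v => if v ∈ A then q2 v else q1 v + t
  have hqB : ∀ v ∉ B, q v = q2 v := by
    intro v hv
    by_cases hvA : v ∈ A
    · exact if_pos hvA
    · exact (if_neg hvA).trans (ht v fun h => h.elim hvA hv)
  have hqA : ∀ v ∉ A, q v = q1 v + t := fun v hv => if_neg hv
  refine ⟨q, fun x y hxy => ?_⟩
  by_cases hx : x ∈ A ∨ y ∈ A
  · have hB : x ∉ B ∧ y ∉ B := by
      rcases hx with hx | hy
      · exact ⟨fun hB => hAB.disjoint.ne_of_mem hx hB rfl, fun hB => hAB.not_adj x hx y hB hxy⟩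
      · exact ⟨fun hB => hAB.not_adj y hy x hB hxy.symm,
          fun hB => hAB.disjoint.ne_of_mem hy hB rfl⟩
    rw [hqB x hB.1, hqB y hB.2]
    exact h2 x hB.1 y hB.2 hxy
  · push Not at hx
    rw [hqA x hx.1, hqA y hx.2, add_sub_add_right_eq_sub]
    exact h1 x hx.1 y hx.2 hxy

/-- If the side `A` of a separation with separator `{a, b}` can always be placed, the other side
together with the edge `ab`, which is a proper minor, determines a realization. -/
theorem IsExcludedMinorFInftyLE.not_extends [Finite V] (h : G.IsExcludedMinorFInftyLE 2)
    {A B : Set V} {a b : V} (hAB : G.Splits A B) (hc : (A ∪ B)ᶜ = {a, b}) (hab : a ≠ b) :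
    ¬ G.Extends A a b := by
  classical
  intro hext
  have hmem : ∀ p, p ∈ ({a, b} : Set V) ↔ p ∉ A ∪ B := fun p => by
    rw [← hc]
    rfl
  have haA : a ∉ A := fun h => (hmem a).1 (by simp) (Or.inl h)
  have hbA : b ∉ A := fun h => (hmem b).1 (by simp) (Or.inl h)
  have hnA : ∀ x ∈ A, ∀ y, G.Adj x y → y ∈ A ∨ y = a ∨ y = b := by
    intro x hx y hxy
    by_cases hy : y ∈ A
    · exact Or.inl hy
    · exact Or.inr ((hmem y).2 fun h' => h'.elim hy fun hB => hAB.not_adj x hx y hB hxy)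
  obtain ⟨c, hcB⟩ := hAB.nonempty_right
  have hcA : c ∉ A := fun h => hAB.disjoint.ne_of_mem h hcB rfl
  have hca : c ≠ a := fun h => (hmem c).1 (by simp [h]) (Or.inr hcB)
  have hcb : c ≠ b := fun h => (hmem c).1 (by simp [h]) (Or.inr hcB)
  let K : SimpleGraph (Aᶜ : Set V) :=
    { Adj := fun x y => x ≠ y ∧ (G.Adj x y ∨ ((x : V) = a ∧ (y : V) = b) ∨
        ((x : V) = b ∧ (y : V) = a))
      symm := ⟨fun x y h => ⟨h.1.symm, h.2.imp (fun h => h.symm) fun h => h.symm.imp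
        (fun h => ⟨h.2, h.1⟩) fun h => ⟨h.2, h.1⟩⟩⟩
      loopless := ⟨fun x h => h.1 rfl⟩ }
  -- the minor `K` arises by contracting `A` to `a`
  have hmodel : K.HasModel G := by
    have hconn : G.CutConnected (insert a A) := by
      refine cutConnected_of_forall_notMem a fun t ht h1 hat _ => ?_
      have htA : ∀ x ∈ t, x ∈ A := fun x hx => (ht hx).resolve_left fun h => hat (h ▸ hx)
      obtain ⟨d, hd, v, hv, hvb, hdv⟩ := h.sepOrderGE_two.exists_adj (X := {b}) h1 (by simp)
        ⟨c, fun h => hcA (htA c h), hcb⟩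
      refine ⟨d, hd, v, ⟨?_, hv⟩, hdv⟩
      rcases hnA d (htA d hd) v hdv with h | h | h
      exacts [Or.inr h, Or.inl h, absurd h hvb]
    have hjoin : ∃ d ∈ A, G.Adj d b := by
      obtain ⟨d, hd, v, hv, hva, hdv⟩ := h.sepOrderGE_two.exists_adj (X := {a}) hAB.nonempty_left
        (by simp) ⟨c, hcA, hca⟩
      rcases hnA d hd v hdv with h | h | h
      exacts [absurd h hv, absurd h hva, ⟨d, hd, h ▸ hdv⟩]
    let S : (Aᶜ : Set V) → Set V := fun w => if (w : V) = a then insert a A else {(w : V)}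
    have hSa : ∀ w : (Aᶜ : Set V), (w : V) = a → S w = insert a A := fun w hw => if_pos hw
    have hSn : ∀ w : (Aᶜ : Set V), (w : V) ≠ a → S w = {(w : V)} := fun w hw => if_neg hw
    have hwS : ∀ w : (Aᶜ : Set V), (w : V) ∈ S w := fun w => by
      by_cases hw : (w : V) = a
      · rw [hSa w hw]
        exact Or.inl hw
      · rw [hSn w hw]
        rfl
    refine ⟨S, fun w => ⟨w, hwS w⟩, fun w => ?_, fun w w' hww => ?_, fun w w' hww => ?_⟩
    · by_cases hw : (w : V) = a
      · rw [hSa w hw]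
        exact hconn
      · rw [hSn w hw]
        exact cutConnected_of_subsingleton Set.subsingleton_singleton
    · have hne : (w : V) ≠ w' := fun h => hww (Subtype.ext h)
      by_cases hw : (w : V) = a
      · rw [hSa w hw, hSn w' fun h => hne (hw.trans h.symm), Set.disjoint_singleton_right]
        rintro (h | h)
        exacts [hne (hw.trans h.symm), w'.2 h]
      · by_cases hw' : (w' : V) = a
        · rw [hSn w hw, hSa w' hw', Set.disjoint_singleton_left]
          rintro (h | h)
          exacts [hw h, w.2 h]
        · rw [hSn w hw, hSn w' hw', Set.disjoint_singleton]
          exact hne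
    · obtain ⟨d, hd, hdb⟩ := hjoin
      rcases hww.2 with h | ⟨ha, hb⟩ | ⟨hb, ha⟩
      · exact ⟨w, hwS w, w', hwS w', h⟩
      · refine ⟨d, ?_, w', hwS w', hb ▸ hdb⟩
        rw [hSa w ha]
        exact Or.inr hd
      · refine ⟨w, hwS w, d, ?_, hb ▸ hdb.symm⟩
        rw [hSa w' ha]
        exact Or.inr hd
  refine h.not_realizable fun m r => ?_
  obtain ⟨q0, hq0⟩ := h.realizable_of_card_lt hmodel hAB.card_lt m fun v => r v
  let q : V → Fin 2 → ℝ := fun v => if hv : v ∉ A then q0 ⟨v, hv⟩ else 0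
  have hq : ∀ v (hv : v ∉ A), q v = q0 ⟨v, hv⟩ := fun v hv => dif_pos hv
  obtain ⟨q', h1, h2⟩ := hext m r q (by
    rw [hq a haA, hq b hbA]
    exact hq0 ⟨a, haA⟩ ⟨b, hbA⟩
      ⟨fun h => hab (congrArg Subtype.val h), Or.inr (Or.inl ⟨rfl, rfl⟩)⟩)
  refine ⟨q', fun x y hxy => ?_⟩
  by_cases hx : x ∈ A
  · exact h2 x hx y hxy
  by_cases hy : y ∈ A
  · rw [norm_sub_rev, h2 y hy x hxy.symm, norm_sub_rev]
  rw [h1 x hx, h1 y hy, hq x hx, hq y hy]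
  exact hq0 ⟨x, hx⟩ ⟨y, hy⟩ ⟨fun h => hxy.ne (congrArg Subtype.val h), Or.inl hxy⟩

/-- Rooted models on both sides of a separation are glued at the two roots. -/
theorem Splits.hasModel_twoSumK4K4 {A B : Set V} {a b : V} (hAB : G.Splits A B)
    (haA : a ∉ A) (hbA : b ∉ A) (haB : a ∉ B) (hbB : b ∉ B)
    {P Q S T P' Q' S' T' : Set V} (h : G.IsRootedModel A a b P Q S T)
    (h' : G.IsRootedModel B a b P' Q' S' T') : twoSumK4K4.HasModel G := by
  let f : Fin 6 → Set V
    | 0 => P ∪ P'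
    | 1 => Q ∪ Q'
    | 2 => S
    | 3 => T
    | 4 => S'
    | 5 => T'
  have hin : ∀ (a : V) (X Y A B : Set V), X ⊆ insert a A → Y ⊆ B → a ∉ B → Disjoint A B →
      Disjoint X Y := by
    intro a X Y A B hX hY ha hAB
    refine Set.disjoint_left.2 fun x hx hy => ?_
    rcases hX hx with rfl | hxA
    exacts [ha (hY hy), hAB.ne_of_mem hxA (hY hy) rfl]
  have hroot : ∀ (A B P Q' : Set V) (a b : V), P ⊆ insert a A → Q' ⊆ insert b B → a ∉ Q' →
      b ∉ A → Disjoint A B → Disjoint P Q' := by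
    intro A B P Q' a b hP hQ haQ hb hAB
    refine Set.disjoint_left.2 fun x hx hy => ?_
    rcases hP hx with rfl | hxA
    · exact haQ hy
    · rcases hQ hy with rfl | hxB
      exacts [hb hxA, hAB.ne_of_mem hxA hxB rfl]
  have hd := hAB.disjoint
  have d01 : Disjoint (P ∪ P') (Q ∪ Q') := by
    rw [Set.disjoint_union_left, Set.disjoint_union_right, Set.disjoint_union_right]
    exact ⟨⟨h.disPQ, hroot A B P Q' a b h.subP h'.subQ
      (fun hh => h'.disPQ.ne_of_mem h'.memP hh rfl) hbA hd⟩,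
      hroot B A P' Q a b h'.subP h.subQ (fun hh => h.disPQ.ne_of_mem h.memP hh rfl) hbB hd.symm,
      h'.disPQ⟩
  have d02 : Disjoint (P ∪ P') S :=
    Set.disjoint_union_left.2 ⟨h.disPS, hin a P' S B A h'.subP h.subS haA hd.symm⟩
  have d03 : Disjoint (P ∪ P') T :=
    Set.disjoint_union_left.2 ⟨h.disPT, hin a P' T B A h'.subP h.subT haA hd.symm⟩
  have d04 : Disjoint (P ∪ P') S' :=
    Set.disjoint_union_left.2 ⟨hin a P S' A B h.subP h'.subS haB hd, h'.disPS⟩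
  have d05 : Disjoint (P ∪ P') T' :=
    Set.disjoint_union_left.2 ⟨hin a P T' A B h.subP h'.subT haB hd, h'.disPT⟩
  have d12 : Disjoint (Q ∪ Q') S :=
    Set.disjoint_union_left.2 ⟨h.disQS, hin b Q' S B A h'.subQ h.subS hbA hd.symm⟩
  have d13 : Disjoint (Q ∪ Q') T :=
    Set.disjoint_union_left.2 ⟨h.disQT, hin b Q' T B A h'.subQ h.subT hbA hd.symm⟩
  have d14 : Disjoint (Q ∪ Q') S' :=
    Set.disjoint_union_left.2 ⟨hin b Q S' A B h.subQ h'.subS hbB hd, h'.disQS⟩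
  have d15 : Disjoint (Q ∪ Q') T' :=
    Set.disjoint_union_left.2 ⟨hin b Q T' A B h.subQ h'.subT hbB hd, h'.disQT⟩
  have hlt : ∀ i j : Fin 6, i < j → Disjoint (f i) (f j) := by
    intro i j hij
    fin_cases i <;> fin_cases j <;>
      first
        | exact absurd hij (by decide)
        | exact d01 | exact d02 | exact d03 | exact d04 | exact d05
        | exact d12 | exact d13 | exact d14 | exact d15
        | exact h.disST | exact h'.disST
        | exact Set.disjoint_of_subset h.subS h'.subS hd
        | exact Set.disjoint_of_subset h.subS h'.subT hd
        | exact Set.disjoint_of_subset h.subT h'.subS hd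
        | exact Set.disjoint_of_subset h.subT h'.subT hd
  refine ⟨f, fun i => ?_, fun i => ?_, fun i j hij => ?_, ?_⟩
  · obtain ⟨p, hp, q, hq, -⟩ := h.joinST
    obtain ⟨p', hp', q', hq', -⟩ := h'.joinST
    fin_cases i
    exacts [⟨a, Or.inl h.memP⟩, ⟨b, Or.inl h.memQ⟩, ⟨p, hp⟩, ⟨q, hq⟩, ⟨p', hp'⟩, ⟨q', hq'⟩]
  · fin_cases i
    exacts [h.connP.union h'.connP h.memP h'.memP, h.connQ.union h'.connQ h.memQ h'.memQ,
      h.connS, h.connT, h'.connS, h'.connT]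
  · rcases lt_or_gt_of_ne hij with hij | hij
    exacts [hlt i j hij, (hlt j i hij).symm]
  · exact forall_adj_twoSumK4K4 (P := fun i j => G.Joined (f i) (f j)) (fun _ _ h => h.symm)
      (h.joinPS.mono Set.subset_union_left subset_rfl)
      (h.joinPT.mono Set.subset_union_left subset_rfl)
      (h.joinQS.mono Set.subset_union_left subset_rfl)
      (h.joinQT.mono Set.subset_union_left subset_rfl) h.joinST
      (h'.joinPS.mono Set.subset_union_right subset_rfl)
      (h'.joinPT.mono Set.subset_union_right subset_rfl)
      (h'.joinQS.mono Set.subset_union_right subset_rfl)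
      (h'.joinQT.mono Set.subset_union_right subset_rfl) h'.joinST

theorem IsExcludedMinorFInftyLE.exists_rootedModel [Finite V] (h : G.IsExcludedMinorFInftyLE 2)
    {A B : Set V} {a b : V} (hAB : G.Splits A B) (hc : (A ∪ B)ᶜ = {a, b}) (hab : a ≠ b) :
    ∃ P Q S T, G.IsRootedModel A a b P Q S T := by
  have hmem : ∀ p, p ∈ ({a, b} : Set V) ↔ p ∉ A ∪ B := fun p => by
    rw [← hc]
    rfl
  obtain ⟨c, hcB⟩ := hAB.nonempty_right
  refine (h.sepOrderGE_two.rootedModel_or_extends _ A a b rfl hab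
    (fun h => (hmem a).1 (by simp) (Or.inl h)) (fun h => (hmem b).1 (by simp) (Or.inl h)) ?_
    ⟨c, fun h => hAB.disjoint.ne_of_mem h hcB rfl, fun h => (hmem c).1 (by simp [h]) (Or.inr hcB),
      fun h => (hmem c).1 (by simp [h]) (Or.inr hcB)⟩).resolve_right (h.not_extends hAB hc hab)
  intro x hx y hxy
  by_cases hy : y ∈ A
  · exact Or.inl hy
  · exact Or.inr ((hmem y).2 fun h' => h'.elim hy fun hB => hAB.not_adj x hx y hB hxy)

theorem IsExcludedMinorFInftyLE.iso_or_iso [Finite V] (h : G.IsExcludedMinorFInftyLE 2) :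
    Nonempty (G ≃g wheelGraph 4) ∨ Nonempty (G ≃g twoSumK4K4) := by
  by_cases h3 : G.SepOrderGE 3
  · left
    have hcard : 5 ≤ Nat.card V := by
      by_contra hlt
      exact h.not_realizable (ellInftyRealizable_two_of_card_le (by omega))
    exact h.nonempty_iso (SepOrderGE.hasModel_wheelGraph (Nat.card V - 5) V G h3 (by omega))
      not_ellInftyRealizable_wheelGraph
  · right
    unfold SepOrderGE at h3
    push Not at h3
    obtain ⟨A, B, hAB, hlt⟩ := h3
    have h2 := h.sepOrderGE_two A B hAB
    obtain ⟨a, b, hab, hc⟩ := Set.ncard_eq_two.1 (show (A ∪ B)ᶜ.ncard = 2 by omega)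
    obtain ⟨P, Q, S, T, hr⟩ := h.exists_rootedModel hAB hc hab
    obtain ⟨P', Q', S', T', hr'⟩ := h.exists_rootedModel hAB.symm (by rwa [Set.union_comm]) hab
    have hmem : ∀ p, p ∈ ({a, b} : Set V) → p ∉ A ∪ B := fun p hp => by
      rw [← hc] at hp
      exact hp
    have ha := hmem a (by simp)
    have hb := hmem b (by simp)
    exact h.nonempty_iso (hAB.hasModel_twoSumK4K4 (fun h => ha (Or.inl h))
      (fun h => hb (Or.inl h)) (fun h => ha (Or.inr h)) (fun h => hb (Or.inr h)) hr hr')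
      not_ellInftyRealizable_twoSumK4K4

end SimpleGraph

theorem theorem1p3 :
    (∀ (V : Type u) [Finite V] (G : SimpleGraph V),
      G.IsExcludedMinorFInftyLE 2 ↔
        Nonempty (G ≃g SimpleGraph.wheelGraph 4) ∨ Nonempty (G ≃g SimpleGraph.twoSumK4K4)) ∧
    (SimpleGraph.wheelGraph 4).fInfty = 3 ∧ SimpleGraph.twoSumK4K4.fInfty = 3 := by
  refine ⟨fun V _ G => ⟨fun h => h.iso_or_iso, ?_⟩,
    SimpleGraph.fInfty_eq_three SimpleGraph.not_ellInftyRealizable_wheelGraph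
      SimpleGraph.ellInftyRealizable_three_wheelGraph,
    SimpleGraph.fInfty_eq_three SimpleGraph.not_ellInftyRealizable_twoSumK4K4
      SimpleGraph.ellInftyRealizable_three_twoSumK4K4⟩
  rintro (⟨⟨e⟩⟩ | ⟨⟨e⟩⟩)
  · exact (SimpleGraph.edgeCritical_wheelGraph.of_iso e).isExcludedMinor
      fun h => SimpleGraph.not_ellInftyRealizable_wheelGraph (h.of_iso e.symm)
  · exact (SimpleGraph.edgeCritical_twoSumK4K4.of_iso e).isExcludedMinor
      fun h => SimpleGraph.not_ellInftyRealizable_twoSumK4K4 (h.of_iso e.symm)
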